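/- Let $d>1$ and $n\ge 1$ be integers, and let $G=G(d,1,n)\subset GL_n(\mathbb C)$ be the group of $n\times n$ monomial matrices (exactly one nonzero entry in each row and column) whose nonzero entries are complex $d$th roots of unity. For $u\in G$ let $\operatorname{fix}(u)=\{v\in\mathbb C^n: uv=v\}$; $u$ is a reflection if $\dim\operatorname{fix}(u)=n-1$. An element of $G$ is regular if it has an eigenvector that lies in $\operatorname{fix}(r)$ for no reflection $r\in G$; if the eigenvalue of such an eigenvector is a primitive $m$th root of unity, the integer $m$ is called regular. The Coxeter number $h$ of $G$ is the largest regular integer, and a Coxeter element of $G$ is a regular element of order $h$. Let $c$ be any Coxeter element of $G$ and, for $k\ge 1$ and $r_1,\dots,r_k\ge 0$, let $a^{(d)}_{r_1,\dots,r_k}$ be the number of tuples $(u_1,\dots,u_k)\in G^k$ with $u_1\cdots u_k=c$ and $\dim\operatorname{fix}(u_i)=r_i$ for all $i$. Put $$(x-1)^{(d)}_p=\prod_{j=0}^{p-1}(x-1-jd),\qquad M^n_{p_1,\dots,p_k}=\sum_{t=0}^{\min_i p_i}(-1)^t\binom nt\prod_{i=1}^k\binom{n-t}{p_i-t}.$$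 Then, as identities of polynomials (all sums having finitely many nonzero terms), $$\frac1{|G|}\sum_{r,s\ge0}a^{(d)}_{r,s}x^ry^s=\sum_{p,q\ge0}\binom{n}{p;\,q;\,n-p-q}\frac{(x-1)^{(d)}_p}{d^p\,p!}\,\frac{(y-1)^{(d)}_q}{d^q\,q!},$$ where $\binom{n}{p;q;n-p-q}=\frac{n!}{p!\,q!\,(n-p-q)!}$ if $p+q\le n$ and $0$ otherwise, and more generally, for every $k\ge1$, $$\frac1{|G|^{k-1}}\sum_{r_1,\dots,r_k\ge0}a^{(d)}_{r_1,\dots,r_k}x_1^{r_1}\cdots x_k^{r_k}=\sum_{p_1,\dots,p_k\ge0}M^n_{p_1,\dots,p_k}\prod_{i=1}^k\frac{(x_i-1)^{(d)}_{p_i}}{d^{p_i}\,p_i!}.$$ -/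

import Mathlib

open scoped BigOperators MatrixGroups

noncomputable section

namespace ReflFact

/-- The generalized permutation matrix `[π; a]`: column `j` has its only nonzero entry `a j` in
row `π j`, and this entry is a complex `d`-th root of unity. -/
def monomialMatrix {d n : ℕ} (π : Equiv.Perm (Fin n)) (a : Fin n → rootsOfUnity d ℂ) :
    Matrix (Fin n) (Fin n) ℂ :=
  Matrix.of fun i j => if i = π j then ((a j : ℂˣ) : ℂ) else 0

theorem monomialMatrix_mul {d n : ℕ} (π σ : Equiv.Perm (Fin n))
    (a b : Fin n → rootsOfUnity d ℂ) :
    monomialMatrix π a * monomialMatrix σ b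
      = monomialMatrix (π * σ) (fun j => a (σ j) * b j) := by
  ext i j
  simp only [monomialMatrix, Matrix.mul_apply, Matrix.of_apply]
  rw [Finset.sum_eq_single (σ j)]
  · by_cases h : i = π (σ j) <;> simp [h]
  · intro k _ hk
    simp [hk]
  · simp

theorem monomialMatrix_one {d n : ℕ} :
    monomialMatrix (1 : Equiv.Perm (Fin n)) (fun _ => (1 : rootsOfUnity d ℂ)) = 1 := by
  ext i j
  by_cases h : i = j
  · subst h
    simp [monomialMatrix]
  · simp [monomialMatrix, h]

/-- The group `G(d, 1, n)` of `n × n` monomial matrices all of whose nonzero entries are complex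
`d`-th roots of unity. -/
def Gd1n (d n : ℕ) : Subgroup (GL (Fin n) ℂ) where
  carrier := {g | ∃ (π : Equiv.Perm (Fin n)) (a : Fin n → rootsOfUnity d ℂ),
    (g : Matrix (Fin n) (Fin n) ℂ) = monomialMatrix π a}
  one_mem' := ⟨1, fun _ => 1, by rw [monomialMatrix_one]; rfl⟩
  mul_mem' := by
    rintro g h ⟨π, a, hg⟩ ⟨σ, b, hh⟩
    exact ⟨π * σ, fun j => a (σ j) * b j, by
      rw [Units.val_mul, hg, hh, monomialMatrix_mul]⟩
  inv_mem' := by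
    rintro g ⟨π, a, hg⟩
    refine ⟨π⁻¹, fun j => (a (π⁻¹ j))⁻¹, ?_⟩
    apply Units.inv_eq_of_mul_eq_one_right
    rw [hg, monomialMatrix_mul]
    simpa using monomialMatrix_one

variable {n : ℕ}

/-- The fixed space `{v | g v = v}` of an invertible matrix acting on `ℂⁿ`. -/
def fixedSpace (g : GL (Fin n) ℂ) : Submodule ℂ (Fin n → ℂ) :=
  LinearMap.eqLocus (Matrix.toLin' (g : Matrix (Fin n) (Fin n) ℂ)) LinearMap.id

/-- The dimension of the fixed space. -/
def fixDim (g : GL (Fin n) ℂ) : ℕ := Module.finrank ℂ (fixedSpace g)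

/-- A reflection is an element whose fixed space is a hyperplane. -/
def IsReflection (g : GL (Fin n) ℂ) : Prop := fixDim g + 1 = n

/-- `v` is an eigenvector of `g` with eigenvalue `μ` that lies on the fixed hyperplane of no
reflection in `G`. -/
def IsRegularEigenvector (G : Subgroup (GL (Fin n) ℂ)) (g : GL (Fin n) ℂ) (μ : ℂ)
    (v : Fin n → ℂ) : Prop :=
  Module.End.HasEigenvector (Matrix.toLin' (g : Matrix (Fin n) (Fin n) ℂ)) μ v ∧
    ∀ r ∈ G, IsReflection r → v ∉ fixedSpace r

/-- An element of `G` is regular if it has a regular eigenvector. -/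
def IsRegularElement (G : Subgroup (GL (Fin n) ℂ)) (g : GL (Fin n) ℂ) : Prop :=
  g ∈ G ∧ ∃ (μ : ℂ) (v : Fin n → ℂ), IsRegularEigenvector G g μ v

/-- An integer `m` is regular for `G` if some element of `G` has a regular eigenvector whose
eigenvalue is a primitive `m`-th root of unity. -/
def IsRegularNumber (G : Subgroup (GL (Fin n) ℂ)) (m : ℕ) : Prop :=
  ∃ g ∈ G, ∃ (μ : ℂ) (v : Fin n → ℂ), IsRegularEigenvector G g μ v ∧ IsPrimitiveRoot μ m

/-- `h` is the Coxeter number of `G`: the largest regular integer. -/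
def IsCoxeterNumber (G : Subgroup (GL (Fin n) ℂ)) (h : ℕ) : Prop :=
  IsGreatest {m : ℕ | IsRegularNumber G m} h

/-- A Coxeter element of `G` is a regular element whose order is the Coxeter number. -/
def IsCoxeterElement (G : Subgroup (GL (Fin n) ℂ)) (c : GL (Fin n) ℂ) : Prop :=
  IsRegularElement G c ∧ IsCoxeterNumber G (orderOf c)

/-- The number of factorizations `c = u₁ ⋯ u_k` with all `u_i` in `G` and `dim fix u_i = r_i`. -/
def factorCount (G : Subgroup (GL (Fin n) ℂ)) (c : GL (Fin n) ℂ) {k : ℕ} (r : Fin k → ℕ) : ℕ :=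
  Nat.card {u : Fin k → G //
    (List.ofFn fun i => (u i : GL (Fin n) ℂ)).prod = c ∧ ∀ i, fixDim (u i : GL (Fin n) ℂ) = r i}

/-- `M^n_{p₁,…,p_k} = ∑_{t=0}^{min p_i} (-1)^t C(n,t) ∏_i C(n-t, p_i-t)`. For `t > n` the factor
`C(n,t)` is zero, so the truncated subtraction is harmless. -/
def Mcoeff (n : ℕ) {k : ℕ} (p : Fin k → ℕ) : ℤ :=
  ∑ t ∈ Finset.range ((⨅ i, p i) + 1),
    (-1) ^ t * (n.choose t : ℤ) * ∏ i, ((n - t).choose (p i - t) : ℤ)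

/-- The trinomial coefficient `n! / (p! q! (n-p-q)!)`, zero when `p + q > n`. -/
def trinomial (n p q : ℕ) : ℕ :=
  if p + q ≤ n then Nat.multinomial Finset.univ ![p, q, n - p - q] else 0

/-- `(x - 1)^{(d)}_p = (x - 1)(x - 1 - d) ⋯ (x - 1 - (p - 1) d)` at the variable `x = x_i`. -/
def basisPoly {ι : Type} (d p : ℕ) (i : ι) : MvPolynomial ι ℚ :=
  ∏ j ∈ Finset.range p, (MvPolynomial.X i - 1 - MvPolynomial.C ((j : ℚ) * (d : ℚ)))

/-- `(x - 1)^{(d)}_p / (d^p p!)` at the variable `x = x_i`. -/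
def normBasisPoly {ι : Type} (d p : ℕ) (i : ι) : MvPolynomial ι ℚ :=
  MvPolynomial.C (((d : ℚ) ^ p * (p.factorial : ℚ))⁻¹) * basisPoly d p i

end ReflFact

end

/-!
For a character `χ` of the group `μ_d` of `d`-th roots of unity, `[π; a] ↦ χ (∏ a) π` extends to a
homomorphism from the group algebra of `G(d, 1, n)` to that of the symmetric group. It sends
`∑ g, x ^ dim fix g • g` to `d ^ n` times the cycle sum `Z y = ∑ π, y ^ (number of cycles) • π`,
where `d y = x - 1 + d` if `χ` is trivial and `d y = x - 1` otherwise. A Coxeter element is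
`[π; a]` with `π` a long cycle and `∏ a ≠ 1`, so character inversion over `μ_d` shows that at
`x_i = 1 + d z_i` its factorizations are counted, up to a power of `d ^ n`, by the difference
between the coefficients of `π` in `∏ Z (z_i + 1)` and `∏ Z (z_i)`.

Only hooks contribute to the coefficient of a long cycle. By the Jucys–Murphy recursion, `Z y` acts
on the Young symmetrizer of the hook with leg length `r` by the content product
`∏ l < n, (y + l - r)`. For natural numbers `z_i` these products are factorials times binomial
coefficients, while `(x_i - 1)^{(d)}_p / (d ^ p p!)` becomes `C(z_i, p)`, and Vandermonde's identity
matches the two sides.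
-/

noncomputable section

namespace ReflFact

open Equiv Finset
open MonoidAlgebra (of)

/-! ### Young symmetrizers of hook shape -/

section YoungSums

variable {α : Type*}

/-- The Young subgroup of the permutations that fix every point outside `S`. -/
def permsOn (S : Finset α) : Subgroup (Perm α) :=
  fixingSubgroup (Perm α) (S : Set α)ᶜ

theorem mem_permsOn {S : Finset α} {π : Perm α} : π ∈ permsOn S ↔ ∀ i ∉ S, π i = i := by
  simp [permsOn, mem_fixingSubgroup_iff]

theorem apply_mem_iff_of_mem_permsOn {S : Finset α} {π : Perm α} (h : π ∈ permsOn S) {i : α} :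
    π i ∈ S ↔ i ∈ S := by
  by_cases hi : i ∈ S
  · refine iff_of_true (by_contra fun hc => hc ?_) hi
    rwa [π.injective (mem_permsOn.1 h _ hc)]
  · rw [mem_permsOn.1 h i hi]

theorem permsOn_mono {S T : Finset α} (h : S ⊆ T) : permsOn S ≤ permsOn T := fun _ hπ =>
  mem_permsOn.2 fun i hi => mem_permsOn.1 hπ i fun hS => hi (h hS)

theorem conj_mem_permsOn_map {S : Finset α} {π : Perm α} (g : Perm α) :
    g * π * g⁻¹ ∈ permsOn (S.map g.toEmbedding) ↔ π ∈ permsOn S := by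
  simp only [mem_permsOn]
  refine g.symm.forall_congr fun i => ?_
  simp [Perm.mul_apply, ← Equiv.eq_symm_apply, Perm.inv_def]

variable [DecidableEq α]

theorem swap_mem_permsOn {S : Finset α} {i j : α} (hi : i ∈ S) (hj : j ∈ S) :
    swap i j ∈ permsOn S :=
  mem_permsOn.2 fun _ hx =>
    swap_apply_of_ne_of_ne (ne_of_mem_of_not_mem hi hx).symm (ne_of_mem_of_not_mem hj hx).symm

variable (R : Type*) [CommRing R]

theorem commute_of_sum_swap {π : Perm α} {a : α} (hπ : π a = a) {S : Finset α}
    (hS : ∀ i, π i ∈ S ↔ i ∈ S) (ε : Perm α →* ℤˣ) :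
    Commute (of R _ π) (∑ i ∈ S, ε (swap a i) • of R _ (swap a i)) := by
  rw [commute_iff_eq, mul_sum, sum_mul]
  refine sum_equiv π (by simp [hS]) fun i _ => ?_
  have hconj : swap a (π i) = π * swap a i * π⁻¹ := by
    rw [Equiv.mul_swap_eq_swap_mul, hπ, mul_inv_cancel_right]
  rw [mul_smul_comm, smul_mul_assoc, ← map_mul, ← map_mul, hconj, inv_mul_cancel_right]
  simp [mul_right_comm]

variable [Fintype α]

instance (S : Finset α) : DecidablePred (· ∈ permsOn S) := fun _ =>
  decidable_of_iff _ mem_permsOn.symm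

/-- The sum of the permutations supported in `S`, weighted by the linear character `ε`. -/
def youngSum (ε : Perm α →* ℤˣ) (S : Finset α) : MonoidAlgebra R (Perm α) :=
  ∑ π with π ∈ permsOn S, ε π • of R _ π

theorem of_mul_youngSum (ε : Perm α →* ℤˣ) {S : Finset α} {σ : Perm α} (hσ : σ ∈ permsOn S) :
    of R _ σ * youngSum R ε S = ε σ • youngSum R ε S := by
  rw [youngSum, mul_sum, smul_sum]
  refine sum_equiv (Equiv.mulLeft σ) (by simp [Subgroup.mul_mem_cancel_left _ hσ]) fun π _ => ?_
  rw [coe_mulLeft, mul_smul_comm, ← map_mul, smul_smul, map_mul ε, ← mul_assoc,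
    Int.units_mul_self, one_mul]

theorem youngSum_mul_of (ε : Perm α →* ℤˣ) {S : Finset α} {σ : Perm α} (hσ : σ ∈ permsOn S) :
    youngSum R ε S * of R _ σ = ε σ • youngSum R ε S := by
  rw [youngSum, sum_mul, smul_sum]
  refine sum_equiv (Equiv.mulRight σ) (by simp [Subgroup.mul_mem_cancel_right _ hσ]) fun π _ => ?_
  rw [coe_mulRight, smul_mul_assoc, ← map_mul, smul_smul, map_mul ε, mul_left_comm,
    Int.units_mul_self, mul_one]

theorem conj_youngSum (ε : Perm α →* ℤˣ) (S : Finset α) (g : Perm α) :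
    of R _ g * youngSum R ε S * of R _ g⁻¹ = youngSum R ε (S.map g.toEmbedding) := by
  rw [youngSum, youngSum, mul_sum, sum_mul]
  refine sum_equiv (MulAut.conj g).toEquiv (by simp [conj_mem_permsOn_map]) fun π _ => ?_
  rw [mul_smul_comm, smul_mul_assoc, ← map_mul, ← map_mul]
  simp [mul_right_comm]

theorem youngSum_commute_sum_swap (ε ε' : Perm α →* ℤˣ) {S T : Finset α} {a : α} (ha : a ∉ S)
    (hST : S ⊆ T) :
    Commute (youngSum R ε S) (∑ i ∈ T, ε' (swap a i) • of R _ (swap a i)) := by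
  refine Commute.sum_left _ _ _ fun π hπ => Commute.smul_left ?_ _
  have hπS : π ∈ permsOn S := (mem_filter.1 hπ).2
  exact commute_of_sum_swap R (mem_permsOn.1 hπS a ha)
    (fun i => apply_mem_iff_of_mem_permsOn (permsOn_mono hST hπS)) ε'

theorem youngSum_insert (ε : Perm α →* ℤˣ) {S : Finset α} {a : α} (ha : a ∉ S) :
    youngSum R ε (insert a S) =
      youngSum R ε S * (1 + ∑ i ∈ S, ε (swap a i) • of R _ (swap a i)) := by
  have hone : 1 + ∑ i ∈ S, ε (swap a i) • of R _ (swap a i) =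
      ∑ i ∈ insert a S, ε (swap a i) • of R _ (swap a i) := by
    rw [sum_insert ha, swap_self, ← Perm.one_def, map_one, map_one, one_smul]
  rw [hone, youngSum, youngSum, sum_mul_sum, ← sum_product']
  symm
  refine sum_nbij' (fun p => p.1 * swap a p.2) (fun ρ => (ρ * swap a (ρ⁻¹ a), ρ⁻¹ a)) ?_ ?_ ?_ ?_ ?_
  · rintro ⟨π, i⟩ h
    simp only [mem_product, mem_filter, mem_univ, true_and] at h ⊢
    exact mul_mem (permsOn_mono (subset_insert _ _) h.1)
      (swap_mem_permsOn (mem_insert_self _ _) h.2)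
  · intro ρ h
    simp only [mem_product, mem_filter, mem_univ, true_and] at h ⊢
    have hi : ρ⁻¹ a ∈ insert a S :=
      (apply_mem_iff_of_mem_permsOn (inv_mem h)).2 (mem_insert_self _ _)
    have hmem := mul_mem h (swap_mem_permsOn (mem_insert_self _ _) hi)
    refine ⟨mem_permsOn.2 fun j hj => ?_, hi⟩
    obtain rfl | hja := eq_or_ne j a
    · simp
    · exact mem_permsOn.1 hmem j (by simp [hja, hj])
  · rintro ⟨π, i⟩ h
    simp only [mem_product, mem_filter, mem_univ, true_and] at h
    have hinv : (π * swap a i)⁻¹ a = i := by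
      rw [Perm.inv_eq_iff_eq, Perm.mul_apply, swap_apply_right, mem_permsOn.1 h.1 a ha]
    simp only [hinv, mul_assoc, swap_mul_self, mul_one]
  · intro ρ _
    simp [mul_assoc]
  · rintro ⟨π, i⟩ _
    rw [smul_mul_smul_comm, ← map_mul, ← map_mul]

theorem youngSum_insert' (ε : Perm α →* ℤˣ) {S : Finset α} {a : α} (ha : a ∉ S) :
    youngSum R ε (insert a S) =
      (1 + ∑ i ∈ S, ε (swap a i) • of R _ (swap a i)) * youngSum R ε S := by
  rw [youngSum_insert R ε ha]
  exact ((Commute.one_right _).add_right (youngSum_commute_sum_swap R ε ε ha subset_rfl)).eq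

/-- The hook element `A_S B_T` with antisymmetrized set `S` and symmetrized set `T`. It is a Young
symmetrizer, up to a scalar, when `S ∪ T` is everything and `S ∩ T` is a point. -/
def hookElement (S T : Finset α) : MonoidAlgebra R (Perm α) :=
  youngSum R Perm.sign S * youngSum R 1 T

theorem conj_hookElement (S T : Finset α) (g : Perm α) :
    of R _ g * hookElement R S T * of R _ g⁻¹
      = hookElement R (S.map g.toEmbedding) (T.map g.toEmbedding) := by
  have hinv : of R _ g⁻¹ * of R _ g = 1 := by rw [← map_mul, inv_mul_cancel, map_one]
  simp only [hookElement, ← conj_youngSum, mul_assoc]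
  rw [← mul_assoc (of R _ g⁻¹), hinv, one_mul]

theorem hookElement_insert_left {S T : Finset α} {b : α} (hb : b ∉ S) :
    hookElement R (insert b S) T = hookElement R S T -
      ∑ a ∈ S, youngSum R Perm.sign S * of R _ (swap a b) * youngSum R 1 T := by
  rw [hookElement, youngSum_insert _ _ hb, mul_add, mul_one, add_mul, sub_eq_add_neg, hookElement,
    mul_sum, sum_mul, ← sum_neg_distrib]
  congr 1
  refine sum_congr rfl fun a ha => ?_
  rw [Perm.sign_swap (ne_of_mem_of_not_mem ha hb).symm, swap_comm]
  simp

theorem hookElement_insert_right {S T : Finset α} {a : α} (ha : a ∉ T) :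
    hookElement R S (insert a T) = hookElement R S T +
      ∑ b ∈ T, youngSum R Perm.sign S * of R _ (swap a b) * youngSum R 1 T := by
  simp [hookElement, youngSum_insert' _ _ ha, add_mul, mul_add, sum_mul, mul_sum, mul_assoc]

theorem card_smul_hookElement_compl (S : Finset α) :
    (Fintype.card α : R) • hookElement R S Sᶜ =
      ∑ b ∈ Sᶜ, hookElement R (insert b S) Sᶜ + ∑ a ∈ S, hookElement R S (insert a Sᶜ) := by
  rw [sum_congr rfl fun b hb => hookElement_insert_left R (mem_compl.1 hb),
    sum_congr rfl fun a ha => hookElement_insert_right R (T := Sᶜ) (notMem_compl.2 ha),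
    sum_sub_distrib, sum_add_distrib, sum_comm (s := Sᶜ), sum_const, sum_const,
    ← card_add_card_compl S, Nat.cast_add, add_smul, Nat.cast_smul_eq_nsmul,
    Nat.cast_smul_eq_nsmul]
  abel

end YoungSums

/-! ### Fixed vectors of monomial maps -/

section FixedVectors

variable {K : Type*} [Field K]

/-- The vectors fixed by the monomial map that sends the basis vector `e j` to `a j • e (π j)`. -/
def fixedVectors {α : Type*} (π : Perm α) (a : α → Kˣ) : Submodule K (α → K) where
  carrier := {v | ∀ j, v (π j) = a j * v j}
  add_mem' {v w} hv hw j := by rw [Pi.add_apply, hv, hw, Pi.add_apply, mul_add]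
  zero_mem' := by simp
  smul_mem' c v hv j := by
    rw [Pi.smul_apply, hv, Pi.smul_apply, smul_eq_mul, smul_eq_mul, mul_left_comm]

theorem mem_fixedVectors {α : Type*} {π : Perm α} {a : α → Kˣ} {v : α → K} :
    v ∈ fixedVectors π a ↔ ∀ j, v (π j) = a j * v j := Iff.rfl

theorem finrank_eq_of_tail {n : ℕ} {F : Submodule K (Fin (n + 1) → K)}
    {F' : Submodule K (Fin n → K)} (φ : F' → K)
    (h : ∀ v, v ∈ F ↔ ∃ hv : Fin.tail v ∈ F', v 0 = φ ⟨Fin.tail v, hv⟩) :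
    Module.finrank K F = Module.finrank K F' := by
  refine LinearEquiv.finrank_eq (LinearEquiv.ofBijective
    ((LinearMap.funLeft K K Fin.succ).restrict fun v hv => ((h v).1 hv).1) ⟨?_, ?_⟩)
  · rintro ⟨v, hv⟩ ⟨w, hw⟩ hvw
    have htail : Fin.tail v = Fin.tail w := congrArg Subtype.val hvw
    obtain ⟨_, hv0⟩ := (h v).1 hv
    obtain ⟨_, hw0⟩ := (h w).1 hw
    ext i
    refine Fin.cases ?_ (congrFun htail) i
    simp only [hv0, hw0, htail]
  · rintro ⟨w, hw⟩
    exact ⟨⟨Fin.cons (φ ⟨w, hw⟩) w, (h _).2 ⟨by simpa using hw, by simp⟩⟩, rfl⟩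

theorem finrank_eq_add_one_of_tail {n : ℕ} {F : Submodule K (Fin (n + 1) → K)}
    {F' : Submodule K (Fin n → K)} (h : ∀ v, v ∈ F ↔ Fin.tail v ∈ F') :
    Module.finrank K F = Module.finrank K F' + 1 := by
  have e : F ≃ₗ[K] F' × K := LinearEquiv.ofBijective
    (((LinearMap.funLeft K K Fin.succ).restrict fun v hv => (h v).1 hv).prod
      ((LinearMap.proj 0).domRestrict F)) (by
    constructor
    · rintro ⟨v, hv⟩ ⟨w, hw⟩ hvw
      have htail : Fin.tail v = Fin.tail w := congrArg (fun x => (x.1 : Fin n → K)) hvw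
      have hzero : v 0 = w 0 := congrArg Prod.snd hvw
      ext i
      exact Fin.cases hzero (congrFun htail) i
    · rintro ⟨⟨w, hw⟩, z⟩
      exact ⟨⟨Fin.cons z w, (h _).2 (by simpa using hw)⟩, rfl⟩)
  rw [e.finrank_eq, Module.finrank_prod, Module.finrank_self]

variable {n : ℕ} (e : Perm (Fin n)) (a : Fin (n + 1) → Kˣ)

theorem finrank_fixedVectors_of_zero_eq_one (ha : a 0 = 1) :
    Module.finrank K (fixedVectors (Perm.decomposeFin.symm (0, e)) a) =
      Module.finrank K (fixedVectors e (Fin.tail a)) + 1 := by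
  refine finrank_eq_add_one_of_tail fun v => ?_
  simp [mem_fixedVectors, Fin.forall_fin_succ, Fin.tail, ha]

theorem finrank_fixedVectors_of_zero_ne_one (ha : a 0 ≠ 1) :
    Module.finrank K (fixedVectors (Perm.decomposeFin.symm (0, e)) a) =
      Module.finrank K (fixedVectors e (Fin.tail a)) := by
  refine finrank_eq_of_tail (fun _ => 0) fun v => ?_
  have hzero : v 0 = a 0 * v 0 ↔ v 0 = 0 := by
    rw [eq_comm, mul_left_eq_self₀, Units.val_eq_one, or_iff_right ha]
  simp [mem_fixedVectors, Fin.forall_fin_succ, Fin.tail, hzero, and_comm]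

theorem finrank_fixedVectors_succ (j : Fin n) :
    Module.finrank K (fixedVectors (Perm.decomposeFin.symm (j.succ, e)) a) =
      Module.finrank K (fixedVectors e (Fin.tail a * Pi.mulSingle (e⁻¹ j) (a 0))) := by
  refine finrank_eq_of_tail (fun v => (a 0 : K)⁻¹ * v.1 j) fun v => ?_
  simp only [mem_fixedVectors, Fin.forall_fin_succ, Perm.decomposeFin_symm_apply_zero,
    Perm.decomposeFin_symm_apply_succ, Fin.tail, Pi.mul_apply, exists_prop]
  have hzero : v j.succ = a 0 * v 0 ↔ v 0 = (a 0 : K)⁻¹ * v j.succ := by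
    rw [eq_inv_mul_iff_mul_eq₀ (Units.ne_zero _), eq_comm]
  rw [hzero, and_comm]
  refine and_congr_left fun hv0 => forall_congr' fun i => ?_
  obtain rfl | hi := eq_or_ne j (e i)
  · rw [swap_apply_right, ← Perm.mul_apply, inv_mul_cancel, Perm.one_apply, Pi.mulSingle_eq_same,
      hv0, inv_mul_eq_iff_eq_mul₀ (Units.ne_zero _), Units.val_mul, mul_right_comm,
      mul_comm (a 0 : K)]
  · rw [swap_apply_of_ne_of_ne (Fin.succ_ne_zero _) (by simpa using hi.symm),
      Pi.mulSingle_eq_of_ne (by rintro rfl; simp at hi), mul_one]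

variable (K)

/-- The number of cycles of `π`, fixed points included, as the dimension over `K` of the space of
functions that are constant on the cycles. -/
def numCycles {α : Type*} (π : Perm α) : ℕ := Module.finrank K (fixedVectors π (1 : α → Kˣ))

theorem numCycles_fin_zero (π : Perm (Fin 0)) : numCycles K π = 0 :=
  Module.finrank_zero_of_subsingleton

theorem numCycles_decomposeFin_zero :
    numCycles K (Perm.decomposeFin.symm (0, e)) = numCycles K e + 1 :=
  finrank_fixedVectors_of_zero_eq_one e 1 rfl

theorem numCycles_decomposeFin_succ (j : Fin n) :
    numCycles K (Perm.decomposeFin.symm (j.succ, e)) = numCycles K e := by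
  rw [numCycles, finrank_fixedVectors_succ, Pi.one_apply, Pi.mulSingle_one, mul_one]
  rfl

theorem numCycles_conj {α : Type*} (g π : Perm α) :
    numCycles K (g * π * g⁻¹) = numCycles K π := by
  refine LinearEquiv.finrank_eq (LinearEquiv.ofSubmodules
    (LinearEquiv.funCongrLeft K K g) _ _ (Submodule.ext fun v => ?_))
  rw [Submodule.mem_map_equiv, mem_fixedVectors, mem_fixedVectors, ← g.forall_congr_right]
  simp [LinearEquiv.funCongrLeft, LinearMap.funLeft]

end FixedVectors

section TwistedSum

variable {K : Type*} [Field K] {U : Subgroup Kˣ} [Fintype U] (χ : U →* K) (x : K)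

/-- The generating function of the fixed space dimensions of the monomial maps over `π` with
entries in `U`, twisted by the character `[π; a] ↦ χ (∏ a)`. -/
def twistedSum {n : ℕ} (π : Perm (Fin n)) : K :=
  ∑ a : Fin n → U, χ (∏ i, a i) * x ^ Module.finrank K (fixedVectors π fun i => (a i : Kˣ))

theorem twistedSum_eq_sum_cons {n : ℕ} (π : Perm (Fin (n + 1))) :
    twistedSum χ x π = ∑ ζ : U, ∑ a : Fin n → U, χ ζ * χ (∏ i, a i) *
      x ^ Module.finrank K (fixedVectors π fun i => ((Fin.cons ζ a : Fin (n + 1) → U) i : Kˣ)) := by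
  rw [twistedSum, ← Fintype.sum_prod_type', ← (Fin.consEquiv fun _ => U).sum_comp]
  refine sum_congr rfl fun p _ => ?_
  rw [← map_mul, ← Fin.prod_cons]
  rfl

theorem twistedSum_decomposeFin_zero {n : ℕ} (e : Perm (Fin n)) :
    twistedSum χ x (Perm.decomposeFin.symm (0, e)) = (x - 1 + ∑ ζ, χ ζ) * twistedSum χ x e := by
  classical
  have hcons (ζ : U) : ∑ a : Fin n → U, χ ζ * χ (∏ i, a i) *
      x ^ Module.finrank K (fixedVectors (Perm.decomposeFin.symm (0, e))
        fun i => ((Fin.cons ζ a : Fin (n + 1) → U) i : Kˣ)) =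
      (χ ζ + if ζ = 1 then x - 1 else 0) * twistedSum χ x e := by
    rw [twistedSum, mul_sum]
    refine sum_congr rfl fun a _ => ?_
    split_ifs with hζ
    · rw [finrank_fixedVectors_of_zero_eq_one _ _ (by simp [hζ]), hζ, map_one, one_mul,
        add_sub_cancel, pow_succ', mul_left_comm]
      rfl
    · rw [finrank_fixedVectors_of_zero_ne_one _ _ (by simpa using hζ), add_zero, mul_assoc]
      rfl
  rw [twistedSum_eq_sum_cons, sum_congr rfl fun ζ _ => hcons ζ, ← sum_mul, sum_add_distrib,
    sum_ite_eq', if_pos (mem_univ _), add_comm]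

theorem twistedSum_decomposeFin_succ {n : ℕ} (e : Perm (Fin n)) (j : Fin n) :
    twistedSum χ x (Perm.decomposeFin.symm (j.succ, e)) = Fintype.card U * twistedSum χ x e := by
  have hcons (ζ : U) : ∑ a : Fin n → U, χ ζ * χ (∏ i, a i) *
      x ^ Module.finrank K (fixedVectors (Perm.decomposeFin.symm (j.succ, e))
        fun i => ((Fin.cons ζ a : Fin (n + 1) → U) i : Kˣ)) = twistedSum χ x e := by
    rw [twistedSum]
    refine Fintype.sum_equiv (Equiv.mulRight (Pi.mulSingle (e⁻¹ j) ζ)) _ _ fun a => ?_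
    have hprod : ζ * ∏ i, a i = ∏ i, (a * (Pi.mulSingle (e⁻¹ j) ζ : Fin n → U)) i := by
      simp only [Pi.mul_apply, prod_mul_distrib]
      rw [prod_pi_mulSingle' (e⁻¹ j) ζ univ, if_pos (mem_univ _), mul_comm ζ]
    have htail : (Fin.tail fun i => ((Fin.cons ζ a : Fin (n + 1) → U) i : Kˣ)) *
        Pi.mulSingle (e⁻¹ j) (ζ : Kˣ) =
          fun i => ((a * (Pi.mulSingle (e⁻¹ j) ζ : Fin n → U)) i : Kˣ) := by
      ext i
      generalize e⁻¹ j = k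
      obtain rfl | hi := eq_or_ne i k <;> simp [Fin.tail, *]
    rw [finrank_fixedVectors_succ, Fin.cons_zero, htail, ← map_mul, hprod, coe_mulRight]
  rw [twistedSum_eq_sum_cons, sum_congr rfl fun ζ _ => hcons ζ, sum_const, card_univ,
    nsmul_eq_mul]

theorem twistedSum_eq {y : K} (hy : Fintype.card U * y = x - 1 + ∑ ζ, χ ζ) {n : ℕ}
    (π : Perm (Fin n)) : twistedSum χ x π = Fintype.card U ^ n * y ^ numCycles K π := by
  induction n with
  | zero =>
    have hrank (a : Fin 0 → Kˣ) : Module.finrank K (fixedVectors π a) = 0 :=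
      Module.finrank_zero_of_subsingleton
    simp [twistedSum, numCycles, hrank]
  | succ n ih =>
    obtain ⟨⟨p, e⟩, rfl⟩ := Perm.decomposeFin.symm.surjective π
    induction p using Fin.cases with
    | zero =>
      rw [twistedSum_decomposeFin_zero, ih, ← hy, numCycles_decomposeFin_zero]
      ring
    | succ j =>
      rw [twistedSum_decomposeFin_succ, ih, numCycles_decomposeFin_succ]
      ring

end TwistedSum

/-! ### Eigenvalues of the cycle sum on the hook elements -/

section GroupAlgebra

variable {R : Type*} [CommSemiring R] {G : Type*}

theorem coeff_of [Monoid G] [DecidableEq G] (g h : G) :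
    (of R G g).coeff h = if g = h then 1 else 0 := by
  rw [MonoidAlgebra.of_apply, MonoidAlgebra.coeff_single, Finsupp.single_apply]

theorem coeff_sum_smul_of [Monoid G] [Fintype G] (f : G → R) (g : G) :
    (∑ u, f u • of R G u).coeff g = f g := by
  classical
  simp [MonoidAlgebra.coeff_sum, Finsupp.single_apply]

theorem commute_of_iff [Group G] {g : G} {x : MonoidAlgebra R G} :
    Commute (of R G g) x ↔ ∀ u, x.coeff (g * u * g⁻¹) = x.coeff u := by
  rw [commute_iff_eq, ← MonoidAlgebra.coeff_inj, DFunLike.ext_iff,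
    ← (Equiv.mulLeft g).forall_congr_right]
  refine forall_congr' fun u => ?_
  rw [MonoidAlgebra.of_apply, coe_mulLeft, MonoidAlgebra.coeff_single_mul_apply,
    MonoidAlgebra.coeff_mul_single_apply, one_mul, mul_one, inv_mul_cancel_left, eq_comm]

end GroupAlgebra

section HookSwap

variable (K : Type*) [Field K] {α : Type*} [Fintype α] [DecidableEq α]

theorem mul_hookElement_of_map {P : MonoidAlgebra K (Perm α)} {g : Perm α}
    (hP : Commute (of K _ g⁻¹) P) {S T : Finset α} {c : K}
    (h : P * hookElement K (S.map g.toEmbedding) (T.map g.toEmbedding) =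
      c • hookElement K (S.map g.toEmbedding) (T.map g.toEmbedding)) :
    P * hookElement K S T = c • hookElement K S T := by
  have hinv : of K _ g⁻¹ * of K _ g = 1 := by rw [← map_mul, inv_mul_cancel, map_one]
  have hconj : hookElement K S T = of K _ g⁻¹ *
      hookElement K (S.map g.toEmbedding) (T.map g.toEmbedding) * of K _ g := by
    rw [← conj_hookElement, mul_assoc, mul_assoc, hinv, mul_one, ← mul_assoc, hinv, one_mul]
  rw [hconj, ← mul_assoc, ← mul_assoc, ← hP.eq, mul_assoc (of K _ g⁻¹), h, mul_smul_comm,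
    smul_mul_assoc]

theorem youngSum_mul_swap_mul_youngSum (S : Finset α) {T : Finset α} {c p : α} (hc : c ∈ T)
    (hp : p ∈ T) :
    youngSum K Perm.sign S * of K _ (swap c p) * youngSum K 1 T = hookElement K S T := by
  rw [mul_assoc, of_mul_youngSum _ _ (swap_mem_permsOn hc hp), MonoidHom.one_apply, one_smul,
    hookElement]

theorem youngSum_mul_swap_mul_youngSum_eq_zero [CharZero K] {S T : Finset α} {a c p : α}
    (haS : a ∈ S) (haT : a ∈ T) (hcS : c ∉ S) (hcT : c ∈ T) (hpS : p ∈ S) (hpa : p ≠ a) :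
    youngSum K Perm.sign S * of K _ (swap c p) * youngSum K 1 T = 0 := by
  have hca : of K _ (swap c a) * youngSum K 1 T = youngSum K 1 T := by
    rw [of_mul_youngSum _ _ (swap_mem_permsOn hcT haT), MonoidHom.one_apply, one_smul]
  have hpa' : youngSum K Perm.sign S * of K _ (swap p a) = -youngSum K Perm.sign S := by
    rw [youngSum_mul_of _ _ (swap_mem_permsOn hpS haS), Perm.sign_swap hpa, Units.neg_smul,
      one_smul]
  have hswap : swap c p * swap c a = swap p a * swap c p := by
    rw [Equiv.mul_swap_eq_swap_mul, swap_apply_left,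
      swap_apply_of_ne_of_ne (ne_of_mem_of_not_mem haS hcS) hpa.symm]
  have hneg : youngSum K Perm.sign S * of K _ (swap c p) * youngSum K 1 T =
      -(youngSum K Perm.sign S * of K _ (swap c p) * youngSum K 1 T) := by
    conv_lhs => rw [← hca]
    rw [← mul_assoc, mul_assoc (youngSum _ _ _), ← map_mul, hswap, map_mul, ← mul_assoc, hpa',
      neg_mul, neg_mul]
  rw [← add_eq_zero_iff_eq_neg, ← two_smul K] at hneg
  exact (smul_eq_zero_iff_right two_ne_zero).1 hneg

/-- The Jucys–Murphy element at `c`: the sum of the transpositions that move `c`. -/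
def jucysMurphy (c : α) : MonoidAlgebra K (Perm α) :=
  ∑ p ∈ {c}ᶜ, of K _ (swap c p)

theorem jucysMurphy_mul_hookElement [CharZero K] {S : Finset α} {a c : α} (ha : a ∈ S)
    (hc : c ∉ S) :
    jucysMurphy K c * hookElement K S (insert a Sᶜ) = #Sᶜ • hookElement K S (insert a Sᶜ) := by
  set T := insert a Sᶜ
  have hcT : c ∈ T := mem_insert_of_mem (mem_compl.2 hc)
  have hcomm : Commute (youngSum K Perm.sign S) (jucysMurphy K c) := by
    simpa [jucysMurphy] using youngSum_commute_sum_swap K Perm.sign 1 hc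
      (T := {c}ᶜ) fun i hi => by simpa using ne_of_mem_of_not_mem hi hc
  have hterm (p : α) : youngSum K Perm.sign S * of K _ (swap c p) * youngSum K 1 T =
      if p ∈ T then hookElement K S T else 0 := by
    split_ifs with hp
    · exact youngSum_mul_swap_mul_youngSum K S hcT hp
    · simp only [T, mem_insert, mem_compl, not_or, not_not] at hp
      exact youngSum_mul_swap_mul_youngSum_eq_zero K ha (mem_insert_self _ _) hc hcT hp.2 hp.1
  have hcard : #{p ∈ {c}ᶜ | p ∈ T} = #Sᶜ := by
    rw [filter_mem_eq_inter, inter_comm, ← sdiff_eq_inter_compl, ← erase_eq,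
      card_erase_of_mem hcT, card_insert_of_notMem (by simpa), Nat.add_sub_cancel]
  calc jucysMurphy K c * hookElement K S T
    _ = ∑ p ∈ {c}ᶜ, youngSum K Perm.sign S * of K _ (swap c p) * youngSum K 1 T := by
      rw [hookElement, ← mul_assoc, ← hcomm.eq, jucysMurphy, mul_sum, sum_mul]
    _ = #Sᶜ • hookElement K S T := by
      rw [sum_congr rfl fun p _ => hterm p, ← sum_filter, sum_const, hcard]

end HookSwap

section Lift

/-- Extend a permutation of `Fin n` to `Fin (n + 1)` along `Fin.succ`, fixing `0`. -/
def liftPerm (n : ℕ) : Perm (Fin n) →* Perm (Fin (n + 1)) where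
  toFun e := Perm.decomposeFin.symm (0, e)
  map_one' := by ext i; cases i using Fin.cases <;> simp
  map_mul' e f := by ext i; cases i using Fin.cases <;> simp

theorem decomposeFin_symm_eq {n : ℕ} (p : Fin (n + 1)) (e : Perm (Fin n)) :
    Perm.decomposeFin.symm (p, e) = swap 0 p * liftPerm n e := by
  ext i
  cases i using Fin.cases <;> simp [liftPerm]

theorem liftPerm_mem_permsOn_map {n : ℕ} {S : Finset (Fin n)} {e : Perm (Fin n)} :
    liftPerm n e ∈ permsOn (S.map (Fin.succEmb n)) ↔ e ∈ permsOn S := by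
  simp [mem_permsOn, liftPerm, Fin.forall_fin_succ]

variable (K : Type*) [Field K]

/-- The map of group algebras induced by `liftPerm`. -/
def liftAlg (n : ℕ) : MonoidAlgebra K (Perm (Fin n)) →ₐ[K] MonoidAlgebra K (Perm (Fin (n + 1))) :=
  MonoidAlgebra.lift K _ (Perm (Fin n)) ((of K _).comp (liftPerm n))

theorem liftAlg_of {n : ℕ} (e : Perm (Fin n)) :
    liftAlg K n (of K _ e) = of K _ (liftPerm n e) := by
  simp [liftAlg]

theorem liftAlg_youngSum {n : ℕ} (ε : Perm (Fin n) →* ℤˣ) (ε' : Perm (Fin (n + 1)) →* ℤˣ)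
    (hε : ∀ e, ε' (liftPerm n e) = ε e) (S : Finset (Fin n)) :
    liftAlg K n (youngSum K ε S) = youngSum K ε' (S.map (Fin.succEmb n)) := by
  rw [youngSum, youngSum, map_sum]
  refine sum_nbij (liftPerm n) ?_ ?_ ?_ ?_
  · simp [liftPerm_mem_permsOn_map]
  · intro e _ f _ h
    simpa [liftPerm] using h
  · intro ρ hρ
    simp only [coe_filter, mem_univ, true_and, Set.mem_ofPred_eq] at hρ
    obtain ⟨⟨p, e⟩, rfl⟩ := Perm.decomposeFin.symm.surjective ρ
    obtain rfl : p = 0 := by simpa using mem_permsOn.1 hρ 0 (by simp)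
    exact ⟨e, by simpa using liftPerm_mem_permsOn_map.1 hρ, rfl⟩
  · intro e _
    rw [Units.smul_def, map_zsmul, liftAlg_of, hε, Units.smul_def]

theorem liftAlg_hookElement {n : ℕ} (S T : Finset (Fin n)) :
    liftAlg K n (hookElement K S T) =
      hookElement K (S.map (Fin.succEmb n)) (T.map (Fin.succEmb n)) := by
  rw [hookElement, map_mul, liftAlg_youngSum K Perm.sign Perm.sign (by simp [liftPerm]),
    liftAlg_youngSum K 1 1 (by simp), hookElement]

end Lift

section CycleSum

theorem map_insert_compl {α : Type*} [Fintype α] [DecidableEq α] (g : Perm α) (S : Finset α)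
    (a : α) : (insert a Sᶜ).map g.toEmbedding = insert (g a) (S.map g.toEmbedding)ᶜ := by
  ext i
  simp

variable {K : Type*} [Field K]

/-- The sum of all permutations `π`, weighted by `y` to the number of cycles of `π`. -/
def cycleSum {α : Type*} [Fintype α] [DecidableEq α] (y : K) : MonoidAlgebra K (Perm α) :=
  ∑ π, y ^ numCycles K π • of K _ π

theorem commute_of_cycleSum {α : Type*} [Fintype α] [DecidableEq α] (y : K) (g : Perm α) :
    Commute (of K _ g) (cycleSum y) := by
  refine commute_of_iff.2 fun u => ?_
  rw [cycleSum, coeff_sum_smul_of, coeff_sum_smul_of, numCycles_conj]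

theorem jucysMurphy_fin_zero {n : ℕ} :
    jucysMurphy K (0 : Fin (n + 1)) = ∑ p : Fin n, of K _ (swap 0 p.succ) := by
  rw [jucysMurphy, ← Fin.image_succ_univ, sum_image (Fin.succ_injective n).injOn]

theorem cycleSum_succ (y : K) (n : ℕ) :
    (cycleSum y : MonoidAlgebra K (Perm (Fin (n + 1)))) =
      (y • 1 + jucysMurphy K 0) * liftAlg K n (cycleSum y) := by
  rw [cycleSum, ← Perm.decomposeFin.symm.sum_comp, Fintype.sum_prod_type, Fin.sum_univ_succ,
    add_mul, jucysMurphy_fin_zero, sum_mul, cycleSum, map_sum, mul_sum]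
  simp only [map_smul, liftAlg_of, numCycles_decomposeFin_zero, numCycles_decomposeFin_succ]
  simp only [decomposeFin_symm_eq, map_mul, swap_self, ← Perm.one_def, one_mul, mul_smul_comm,
    smul_mul_assoc, smul_smul, pow_succ, mul_sum]

theorem sum_pow_numCycles_mul_sign (y : K) (n : ℕ) :
    ∑ π : Perm (Fin n), y ^ numCycles K π * ((Perm.sign π : ℤ) : K) = ∏ l ∈ range n, (y - l) := by
  induction n with
  | zero => simp [numCycles_fin_zero]
  | succ n ih =>
    rw [← Perm.decomposeFin.symm.sum_comp, Fintype.sum_prod_type, Fin.sum_univ_succ,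
      prod_range_succ, ← ih]
    simp only [numCycles_decomposeFin_zero, numCycles_decomposeFin_succ,
      Perm.decomposeFin.symm_sign, Fin.succ_ne_zero, if_true, if_false, one_mul, neg_mul,
      Units.val_neg, Int.cast_neg, mul_neg,
      sum_neg_distrib, sum_const, card_univ, Fintype.card_fin, pow_succ, mul_right_comm _ y,
      ← sum_mul]
    rw [nsmul_eq_mul]
    ring

theorem cycleSum_mul_youngSum_sign_univ (y : K) (n : ℕ) :
    cycleSum y * youngSum K Perm.sign (univ : Finset (Fin n)) =
      (∏ l ∈ range n, (y - l)) • youngSum K Perm.sign univ := by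
  rw [cycleSum, sum_mul, ← sum_pow_numCycles_mul_sign, sum_smul]
  refine sum_congr rfl fun π _ => ?_
  rw [smul_mul_assoc, of_mul_youngSum _ _ (mem_permsOn.2 (by simp)), mul_smul, Units.smul_def,
    Int.cast_smul_eq_zsmul]

/-- The content polynomial at `y` of the hook with `n` boxes and leg length `r`, whose contents are
`-r, …, n - 1 - r`. -/
def hookContent (n r : ℕ) (y : K) : K := ∏ l ∈ range n, (y + l - r)

theorem hookContent_succ_self (r : ℕ) (y : K) :
    hookContent (r + 1) r y = ∏ l ∈ range (r + 1), (y - l) := by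
  rw [hookContent, ← prod_range_reflect]
  refine prod_congr rfl fun l hl => ?_
  rw [Nat.add_sub_cancel, Nat.cast_sub (mem_range_succ_iff.1 hl)]
  ring

variable [CharZero K]

theorem cycleSum_mul_hookElement_succ (y : K) {n r : ℕ} {S : Finset (Fin n)} {a : Fin n}
    (ha : a ∈ S) (hr : #S = r + 1)
    (ih : cycleSum y * hookElement K S (insert a Sᶜ) =
      hookContent n r y • hookElement K S (insert a Sᶜ)) :
    cycleSum y * hookElement K (S.map (Fin.succEmb n))
        (insert a.succ (S.map (Fin.succEmb n))ᶜ) =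
      hookContent (n + 1) r y • hookElement K (S.map (Fin.succEmb n))
        (insert a.succ (S.map (Fin.succEmb n))ᶜ) := by
  set S' := S.map (Fin.succEmb n)
  have haS' : a.succ ∈ S' := mem_map_of_mem (Fin.succEmb n) ha
  have hT : insert a.succ S'ᶜ = insert 0 ((insert a Sᶜ).map (Fin.succEmb n)) := by
    ext i
    cases i using Fin.cases <;> simp [S']
  have hlift : liftAlg K n (cycleSum y) * hookElement K S' (insert a.succ S'ᶜ) =
      hookContent n r y • hookElement K S' (insert a.succ S'ᶜ) := by
    rw [hT, hookElement, youngSum_insert _ _ (by simp [-map_insert]),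
      ← mul_assoc (youngSum K Perm.sign S'), ← hookElement, ← liftAlg_hookElement,
      ← mul_assoc, ← map_mul, ih, map_smul, smul_mul_assoc]
  have hcard : (#S'ᶜ : K) = n - r := by
    rw [card_compl, Fintype.card_fin, card_map, hr, Nat.add_sub_add_right, Nat.cast_sub]
    have := card_le_univ S
    rw [Fintype.card_fin] at this
    lia
  rw [cycleSum_succ, mul_assoc, hlift, mul_smul_comm, add_mul, smul_mul_assoc, one_mul,
    jucysMurphy_mul_hookElement K haS' (by simp [S']), ← Nat.cast_smul_eq_nsmul K, hcard,
    ← add_smul, smul_smul, hookContent, hookContent, prod_range_succ, add_sub_assoc y]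

theorem cycleSum_mul_hookElement (y : K) {n r : ℕ} {S : Finset (Fin n)} {a : Fin n} (ha : a ∈ S)
    (hr : #S = r + 1) :
    cycleSum y * hookElement K S (insert a Sᶜ) =
      hookContent n r y • hookElement K S (insert a Sᶜ) := by
  induction n with
  | zero => exact a.elim0
  | succ n ih =>
    obtain rfl | hS := eq_or_ne S univ
    · obtain rfl : n = r := by simpa using hr
      rw [hookElement, ← mul_assoc, cycleSum_mul_youngSum_sign_univ, smul_mul_assoc,
        hookContent_succ_self]
    -- Conjugating by `swap 0 b` with `b ∉ S`, we may assume that `S` avoids `0`.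
    obtain ⟨b, hb⟩ : ∃ b, b ∉ S := by simpa [eq_univ_iff_forall] using hS
    refine mul_hookElement_of_map K (g := swap 0 b) (commute_of_cycleSum y _) ?_
    rw [map_insert_compl]
    have hzero : 0 ∉ S.map (swap 0 b).toEmbedding := by simpa [eq_comm] using hb
    have hmem : swap 0 b a ∈ S.map (swap 0 b).toEmbedding := mem_map_of_mem _ ha
    rw [← card_map (swap 0 b).toEmbedding] at hr
    generalize S.map (swap 0 b).toEmbedding = S₁ at *
    generalize swap 0 b a = a₁ at *
    obtain ⟨S', -, rfl⟩ : ∃ S' ⊆ univ, S₁ = S'.map (Fin.succEmb n) :=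
      subset_map_iff.1 fun i hi => by
        simpa [Fin.exists_succ_eq] using ne_of_mem_of_not_mem hi hzero
    obtain ⟨a', ha', rfl⟩ := mem_map.1 hmem
    rw [card_map] at hr
    exact cycleSum_mul_hookElement_succ y ha' hr (ih ha' hr)

end CycleSum

/-! ### Coefficients of the hook elements -/

section HookCoefficients

theorem mem_iff_of_sameCycle {α : Type*} [Finite α] {S : Finset α} {π : Perm α}
    (h : ∀ i, π i ∈ S ↔ i ∈ S) {x y : α} (hxy : π.SameCycle x y) : y ∈ S ↔ x ∈ S := by
  obtain ⟨k, -, rfl⟩ := hxy.exists_pow_eq'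
  induction k with
  | zero => rfl
  | succ k ih => rw [pow_succ', Perm.mul_apply, h, ih ⟨k, rfl⟩]

theorem eq_one_of_mem_permsOn {α : Type*} [DecidableEq α] {S T : Finset α} (h : #(S ∩ T) ≤ 1)
    {π : Perm α} (hS : π ∈ permsOn S) (hT : π ∈ permsOn T) : π = 1 := by
  ext i
  by_contra hne
  have hi : i ∈ S ∩ T := mem_inter.2
    ⟨not_imp_comm.1 (mem_permsOn.1 hS i) hne, not_imp_comm.1 (mem_permsOn.1 hT i) hne⟩
  have hπi : π i ∈ S ∩ T := by
    rwa [mem_inter, apply_mem_iff_of_mem_permsOn hS, apply_mem_iff_of_mem_permsOn hT, ← mem_inter]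
  exact hne (card_le_one.1 h _ hπi _ hi)

variable (R : Type*) [CommRing R] {α : Type*} [Fintype α] [DecidableEq α]

theorem coeff_hookElement (S T : Finset α) (π : Perm α) :
    (hookElement R S T).coeff π = ∑ σ with σ ∈ permsOn S, ∑ τ with τ ∈ permsOn T,
      if σ * τ = π then ((Perm.sign σ : ℤ) : R) else 0 := by
  simp only [hookElement, youngSum, sum_mul_sum, MonoidAlgebra.coeff_sum, Finsupp.finsetSum_apply,
    smul_mul_smul_comm, ← map_mul, MonoidAlgebra.coeff_smul_apply, coeff_of]
  refine sum_congr rfl fun σ _ => sum_congr rfl fun τ _ => ?_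
  simp [Units.smul_def]

theorem coeff_hookElement_one {S T : Finset α} (h : #(S ∩ T) ≤ 1) :
    (hookElement R S T).coeff 1 = 1 := by
  have hfactor : ∀ σ ∈ permsOn S, ∀ τ ∈ permsOn T, σ * τ = 1 → σ = 1 := fun σ hσ τ hτ hστ =>
    eq_one_of_mem_permsOn h hσ (eq_inv_of_mul_eq_one_left hστ ▸ inv_mem hτ)
  rw [coeff_hookElement, sum_eq_single 1]
  · simp [one_mem]
  · refine fun σ hσ hσ1 => sum_eq_zero fun τ hτ => if_neg fun hστ => hσ1 ?_
    exact hfactor σ (mem_filter.1 hσ).2 τ (mem_filter.1 hτ).2 hστ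
  · simp [one_mem]

theorem coeff_hookElement_mul {S T : Finset α} (h : #(S ∩ T) ≤ 1) {σ τ : Perm α}
    (hσ : σ ∈ permsOn S) (hτ : τ ∈ permsOn T) :
    (hookElement R S T).coeff (σ * τ) = ((Perm.sign σ : ℤ) : R) := by
  have hmul : of R _ σ⁻¹ * hookElement R S T * of R _ τ⁻¹ =
      ((Perm.sign σ : ℤ) : R) • hookElement R S T := by
    rw [hookElement, ← mul_assoc, of_mul_youngSum _ _ (inv_mem hσ), mul_assoc,
      youngSum_mul_of _ _ (inv_mem hτ), smul_mul_assoc, Int.cast_smul_eq_zsmul]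
    simp [Units.smul_def]
  have hcoeff := congrArg (fun z => z.coeff 1) hmul
  simpa only [MonoidAlgebra.of_apply, MonoidAlgebra.coeff_single_mul_apply,
    MonoidAlgebra.coeff_mul_single_apply, one_mul, mul_one, MonoidAlgebra.coeff_smul_apply,
    coeff_hookElement_one R h, inv_inv, smul_eq_mul] using hcoeff

theorem coeff_hookElement_compl_eq_zero {S : Finset α} {π : Perm α}
    (h : ¬∀ i, π i ∈ S ↔ i ∈ S) : (hookElement R S Sᶜ).coeff π = 0 := by
  rw [coeff_hookElement]
  refine sum_eq_zero fun σ hσ => sum_eq_zero fun τ hτ => if_neg ?_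
  rintro rfl
  refine h fun i => ?_
  rw [Perm.mul_apply, apply_mem_iff_of_mem_permsOn (mem_filter.1 hσ).2, ← not_iff_not,
    ← mem_compl, ← mem_compl, apply_mem_iff_of_mem_permsOn (mem_filter.1 hτ).2]

theorem coeff_hookElement_compl {S : Finset α} {π : Perm α} (h : ∀ i, π i ∈ S ↔ i ∈ S) :
    (hookElement R S Sᶜ).coeff π = ((Perm.sign (Perm.ofSubtype (π.subtypePerm h)) : ℤ) : R) := by
  set σ := Perm.ofSubtype (π.subtypePerm h)
  have hσ : σ ∈ permsOn S :=
    mem_permsOn.2 fun i hi => Perm.ofSubtype_subtypePerm_of_not_mem h hi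
  have hτ : σ⁻¹ * π ∈ permsOn Sᶜ := mem_permsOn.2 fun i hi => by
    rw [Perm.mul_apply, Perm.inv_eq_iff_eq,
      Perm.ofSubtype_subtypePerm_of_mem h (notMem_compl.1 hi)]
  rw [← coeff_hookElement_mul R (by simp) hσ hτ, mul_inv_cancel_left]

/-- The orbit of `x` under the permutation `π`. -/
def orbitFinset (π : Perm α) (x : α) : Finset α := {y | π.SameCycle x y}

theorem mem_orbitFinset {π : Perm α} {x y : α} : y ∈ orbitFinset π x ↔ π.SameCycle x y := by
  simp [orbitFinset]

theorem apply_mem_orbitFinset {π : Perm α} {x y : α} :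
    π y ∈ orbitFinset π x ↔ y ∈ orbitFinset π x := by
  rw [mem_orbitFinset, mem_orbitFinset, Perm.sameCycle_apply_right]

theorem sign_cycleOf (π : Perm α) (x : α) :
    Perm.sign (π.cycleOf x) = -(-1) ^ #(orbitFinset π x) := by
  by_cases hx : π x = x
  · have horbit : orbitFinset π x = {x} := by
      ext y
      rw [mem_orbitFinset, mem_singleton]
      exact ⟨fun h => (h.eq_of_left hx).symm, fun h => h ▸ Perm.SameCycle.refl _ _⟩
    rw [(Perm.cycleOf_eq_one_iff π).2 hx, horbit]
    simp
  · have horbit : orbitFinset π x = (π.cycleOf x).support := by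
      ext y
      rw [mem_orbitFinset, Perm.mem_support_cycleOf_iff' hx]
    rw [horbit, (Perm.isCycle_cycleOf π hx).sign]

theorem ofSubtype_subtypePerm_union_orbitFinset {S : Finset α} {π : Perm α} {x : α}
    (h : ∀ i, π i ∈ S ↔ i ∈ S) (hx : x ∉ S)
    (h' : ∀ i, π i ∈ S ∪ orbitFinset π x ↔ i ∈ S ∪ orbitFinset π x) :
    Perm.ofSubtype (π.subtypePerm h') = Perm.ofSubtype (π.subtypePerm h) * π.cycleOf x := by
  ext i
  rw [Perm.mul_apply]
  by_cases hi : π.SameCycle x i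
  · have hiS : π i ∉ S := by rwa [h, mem_iff_of_sameCycle h hi]
    rw [hi.cycleOf_apply, Perm.ofSubtype_subtypePerm_of_not_mem h hiS,
      Perm.ofSubtype_subtypePerm_of_mem h' (mem_union_right _ (mem_orbitFinset.2 hi))]
  · rw [Perm.cycleOf_apply_of_not_sameCycle hi]
    by_cases hiS : i ∈ S
    · rw [Perm.ofSubtype_subtypePerm_of_mem h hiS,
        Perm.ofSubtype_subtypePerm_of_mem h' (mem_union_left _ hiS)]
    · rw [Perm.ofSubtype_subtypePerm_of_not_mem h hiS,
        Perm.ofSubtype_subtypePerm_of_not_mem h' (by simp [hiS, mem_orbitFinset, hi])]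

theorem coeff_hookElement_union_orbitFinset {S : Finset α} {π : Perm α}
    (h : ∀ i, π i ∈ S ↔ i ∈ S) {x : α} (hx : x ∉ S) :
    (-1) ^ #(S ∪ orbitFinset π x) *
        (hookElement R (S ∪ orbitFinset π x) (S ∪ orbitFinset π x)ᶜ).coeff π =
      -((-1) ^ #S * (hookElement R S Sᶜ).coeff π) := by
  have hdisj : Disjoint S (orbitFinset π x) := disjoint_left.2 fun i hi hc =>
    hx ((mem_iff_of_sameCycle h (mem_orbitFinset.1 hc)).1 hi)
  have h' : ∀ i, π i ∈ S ∪ orbitFinset π x ↔ i ∈ S ∪ orbitFinset π x := fun i => by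
    rw [mem_union, mem_union, h, apply_mem_orbitFinset]
  have hsq : (-1 : R) ^ #(orbitFinset π x) * (-1) ^ #(orbitFinset π x) = 1 := by
    rw [← mul_pow]; simp
  rw [coeff_hookElement_compl R h', coeff_hookElement_compl R h,
    ofSubtype_subtypePerm_union_orbitFinset h hx h', Perm.sign_mul, sign_cycleOf,
    card_union_of_disjoint hdisj, pow_add]
  push_cast
  linear_combination (-(-1) ^ #S * ((Perm.sign (Perm.ofSubtype (π.subtypePerm h)) : ℤ) : R)) * hsq

theorem coeff_hookElement_symmDiff_orbitFinset (S : Finset α) (π : Perm α) (x : α) :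
    (-1) ^ #S * (hookElement R S Sᶜ).coeff π +
      (-1) ^ #(symmDiff S (orbitFinset π x)) *
        (hookElement R (symmDiff S (orbitFinset π x)) (symmDiff S (orbitFinset π x))ᶜ).coeff π
      = 0 := by
  by_cases h : ∀ j, π j ∈ S ↔ j ∈ S
  · by_cases hx : x ∈ S
    · have hsub : orbitFinset π x ⊆ S := fun y hy =>
        (mem_iff_of_sameCycle h (mem_orbitFinset.1 hy)).2 hx
      have hdiff : ∀ j, π j ∈ S \ orbitFinset π x ↔ j ∈ S \ orbitFinset π x := fun j => by
        rw [mem_sdiff, mem_sdiff, h, apply_mem_orbitFinset]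
      have hunion := coeff_hookElement_union_orbitFinset R hdiff (x := x)
        fun hc => (mem_sdiff.1 hc).2 (mem_orbitFinset.2 (Perm.SameCycle.refl _ _))
      rw [sdiff_union_of_subset hsub] at hunion
      rw [symmDiff_of_ge hsub, hunion, neg_add_cancel]
    · have hdisj : Disjoint S (orbitFinset π x) := disjoint_left.2 fun y hy hc =>
        hx ((mem_iff_of_sameCycle h (mem_orbitFinset.1 hc)).1 hy)
      rw [hdisj.symmDiff_eq_sup, sup_eq_union, coeff_hookElement_union_orbitFinset R h hx,
        add_neg_cancel]
  · have h' : ¬∀ j, π j ∈ symmDiff S (orbitFinset π x) ↔ j ∈ symmDiff S (orbitFinset π x) := by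
      refine fun h' => h fun j => ?_
      have hj := h' j
      rw [mem_symmDiff, mem_symmDiff, apply_mem_orbitFinset] at hj
      tauto
    rw [coeff_hookElement_compl_eq_zero R h, coeff_hookElement_compl_eq_zero R h', mul_zero,
      mul_zero, add_zero]

theorem sum_coeff_hookElement_of_isCycleOn {π : Perm α} (hπ : π.IsCycleOn Set.univ) (i : α) :
    ∑ S : Finset α with i ∉ S, (-1) ^ #S * (hookElement R S Sᶜ).coeff π = 1 := by
  rw [sum_eq_single ∅]
  · have hempty : ∀ j, π j ∈ (∅ : Finset α) ↔ j ∈ (∅ : Finset α) := by simp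
    have hone : Perm.ofSubtype (π.subtypePerm hempty) = 1 :=
      Perm.ext fun j => Perm.ofSubtype_subtypePerm_of_not_mem hempty (notMem_empty j)
    rw [coeff_hookElement_compl R hempty, hone]
    simp
  · intro S hS hne
    rw [coeff_hookElement_compl_eq_zero, mul_zero]
    intro h
    obtain ⟨x, hx⟩ := nonempty_iff_ne_empty.2 hne
    exact (mem_filter.1 hS).2
      ((mem_iff_of_sameCycle h (hπ.2 (Set.mem_univ i) (Set.mem_univ x))).1 hx)
  · simp

theorem sum_coeff_hookElement_of_not_isCycleOn {π : Perm α} (hπ : ¬π.IsCycleOn Set.univ) (i : α) :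
    ∑ S : Finset α with i ∉ S, (-1) ^ #S * (hookElement R S Sᶜ).coeff π = 0 := by
  obtain ⟨x, hx⟩ : ∃ x, ¬π.SameCycle x i := by
    by_contra! hall
    exact hπ ⟨Set.bijOn_univ.2 π.bijective, fun x _ y _ => (hall x).trans (hall y).symm⟩
  have hi : i ∉ orbitFinset π x := fun h => hx (mem_orbitFinset.1 h)
  have hxx : x ∈ orbitFinset π x := mem_orbitFinset.2 (Perm.SameCycle.refl _ _)
  refine sum_involution (fun S _ => symmDiff S (orbitFinset π x))
    (fun S _ => coeff_hookElement_symmDiff_orbitFinset R S π x) ?_ ?_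
    fun S _ => symmDiff_symmDiff_cancel_right _ _
  · intro S _ _ heq
    have hiff : x ∈ symmDiff S (orbitFinset π x) ↔ x ∈ S := by rw [heq]
    rw [mem_symmDiff] at hiff
    tauto
  · intro S hS
    simp only [mem_filter, mem_univ, true_and, mem_symmDiff] at *
    tauto

end HookCoefficients

/-! ### The coefficient of a long cycle -/

theorem isConj_of_isCycleOn_univ {α : Type*} [Finite α] {π σ : Perm α}
    (hπ : π.IsCycleOn Set.univ) (hσ : σ.IsCycleOn Set.univ) : IsConj π σ := by
  classical
  have := Fintype.ofFinite α
  rcases subsingleton_or_nontrivial α with hα | hα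
  · rw [Subsingleton.elim π σ]
  · have hcycle : ∀ {τ : Perm α}, τ.IsCycleOn Set.univ → τ.IsCycle ∧ τ.support = univ := by
      intro τ hτ
      have hne : ∀ x, τ x ≠ x := fun x => hτ.apply_ne Set.nontrivial_univ (Set.mem_univ x)
      obtain ⟨x⟩ := hα.to_nonempty
      exact ⟨⟨x, hne x, fun y _ => hτ.2 (Set.mem_univ x) (Set.mem_univ y)⟩, by ext y; simp [hne]⟩
    exact (hcycle hπ).1.isConj (hcycle hσ).1 (by rw [(hcycle hπ).2, (hcycle hσ).2])

theorem coeff_mul_one {R G : Type*} [CommSemiring R] [Group G] [Fintype G]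
    (x y : MonoidAlgebra R G) : (x * y).coeff 1 = ∑ g, x.coeff g⁻¹ * y.coeff g := by
  rw [MonoidAlgebra.coeff_mul_apply_right, Finsupp.sum_fintype _ _ (by simp)]
  simp

theorem sum_choose_hook_telescope {R : Type*} [CommRing R] (m : ℕ) (Λ : ℕ → R) :
    ∑ j ∈ range (m + 1), m.choose j • ((-1) ^ j *
      (((m + 1 - j : ℕ) : R) * Λ j + (j : R) * Λ (j - 1))) =
    ∑ r ∈ range (m + 1), (-1) ^ r * (m.choose r : R) * Λ r := by
  simp only [mul_add, smul_add, sum_add_distrib]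
  rw [sum_range_succ' (fun j => m.choose j • ((-1) ^ j * ((j : R) * Λ (j - 1)))),
    sum_range_succ, sum_range_succ (fun r => (-1) ^ r * (m.choose r : R) * Λ r)]
  simp only [Nat.cast_zero, zero_mul, mul_zero, smul_zero, add_zero, Nat.add_sub_cancel]
  rw [add_right_comm, ← sum_add_distrib]
  congr 1
  · refine sum_congr rfl fun r hr => ?_
    have hrm : r ≤ m := (mem_range.1 hr).le
    have hchoose : ((m.choose (r + 1) * (r + 1) : ℕ) : R) = (m.choose r * (m - r) : ℕ) := by
      rw [Nat.choose_succ_right_eq]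
    push_cast [Nat.cast_sub hrm, Nat.cast_sub (Nat.le_succ_of_le hrm), nsmul_eq_mul] at hchoose ⊢
    rw [pow_succ]
    linear_combination (-(-1) ^ r * Λ r) * hchoose
  · simp

section HookEigenvalues

variable {K : Type*} [Field K] {α : Type*} [Fintype α] [DecidableEq α]

/-- The central element `P` of the group algebra acts on every hook element whose antisymmetrized
set has `r + 1` elements by the scalar `Λ r`. -/
structure HasHookEigenvalues (P : MonoidAlgebra K (Perm α)) (Λ : ℕ → K) : Prop where
  commute_of : ∀ g, Commute (of K _ g) P
  mul_hookElement : ∀ {r : ℕ} {S : Finset α} {a : α}, a ∈ S → #S = r + 1 →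
    P * hookElement K S (insert a Sᶜ) = Λ r • hookElement K S (insert a Sᶜ)

theorem hasHookEigenvalues_cycleSum [CharZero K] (n : ℕ) (y : K) :
    HasHookEigenvalues (cycleSum y : MonoidAlgebra K (Perm (Fin n))) fun r => hookContent n r y :=
  ⟨commute_of_cycleSum y, cycleSum_mul_hookElement y⟩

namespace HasHookEigenvalues

variable {P : MonoidAlgebra K (Perm α)} {Λ : ℕ → K}

theorem list_prod {ι : Type*} {P : ι → MonoidAlgebra K (Perm α)} {Λ : ι → ℕ → K} (l : List ι)
    (h : ∀ i, HasHookEigenvalues (P i) (Λ i)) :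
    HasHookEigenvalues (l.map P).prod fun r => (l.map fun i => Λ i r).prod := by
  induction l with
  | nil => exact ⟨fun g => Commute.one_right _, fun _ _ => by simp⟩
  | cons i l ih =>
    refine ⟨fun g => ?_, fun ha hr => ?_⟩
    · rw [List.map_cons, List.prod_cons]
      exact ((h i).commute_of g).mul_right (ih.commute_of g)
    · rw [List.map_cons, List.prod_cons, List.map_cons, List.prod_cons, mul_assoc,
        ih.mul_hookElement ha hr, mul_smul_comm, (h i).mul_hookElement ha hr, smul_smul, mul_comm]

theorem coeff_mul_hookElement_insert (h : HasHookEigenvalues P Λ) {r : ℕ} {S : Finset α} {a : α}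
    (ha : a ∈ S) (hr : #S = r + 1) : (P * hookElement K S (insert a Sᶜ)).coeff 1 = Λ r := by
  rw [h.mul_hookElement ha hr, MonoidAlgebra.coeff_smul_apply, coeff_hookElement_one, smul_eq_mul,
    mul_one]
  simp [inter_insert_of_mem ha]

theorem card_mul_coeff_mul_hookElement_compl (h : HasHookEigenvalues P Λ) (S : Finset α) :
    (Fintype.card α : K) * (P * hookElement K S Sᶜ).coeff 1 =
      ((Fintype.card α - #S : ℕ) : K) * Λ #S + (#S : K) * Λ (#S - 1) := by
  have hadd : ∀ b ∈ Sᶜ, (P * hookElement K (insert b S) Sᶜ).coeff 1 = Λ #S := fun b hb => by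
    have hbS : b ∉ S := mem_compl.1 hb
    rw [← h.coeff_mul_hookElement_insert (mem_insert_self b S) (card_insert_of_notMem hbS),
      compl_insert, insert_erase hb]
  have hremove : ∀ a ∈ S, (P * hookElement K S (insert a Sᶜ)).coeff 1 = Λ (#S - 1) := fun a ha =>
    h.coeff_mul_hookElement_insert ha (Nat.succ_pred_eq_of_pos (card_pos.2 ⟨a, ha⟩)).symm
  rw [← smul_eq_mul, ← MonoidAlgebra.coeff_smul_apply, ← mul_smul_comm, card_smul_hookElement_compl,
    mul_add, mul_sum, mul_sum, MonoidAlgebra.coeff_add, Finsupp.add_apply, MonoidAlgebra.coeff_sum,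
    MonoidAlgebra.coeff_sum, Finsupp.finsetSum_apply, Finsupp.finsetSum_apply, sum_congr rfl hadd,
    sum_congr rfl hremove, sum_const, sum_const, card_compl, nsmul_eq_mul, nsmul_eq_mul]

theorem sum_coeff_mul_hookElement (h : HasHookEigenvalues P Λ) {c : Perm α}
    (hc : c.IsCycleOn Set.univ) (i : α)
    [DecidablePred fun π : Perm α => π.IsCycleOn Set.univ] :
    ∑ S : Finset α with i ∉ S, (-1) ^ #S * (P * hookElement K S Sᶜ).coeff 1 =
      #{π : Perm α | π.IsCycleOn Set.univ} * P.coeff c := by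
  have hcoeff : ∀ π : Perm α, π.IsCycleOn Set.univ → P.coeff π⁻¹ = P.coeff c := fun π hπ => by
    obtain ⟨g, hg⟩ := isConj_iff.1 (isConj_of_isCycleOn_univ hc hπ.inv)
    rw [← hg, commute_of_iff.1 (h.commute_of g)]
  have hterm : ∀ π : Perm α, ∑ S : Finset α with i ∉ S,
      (-1) ^ #S * (P.coeff π⁻¹ * (hookElement K S Sᶜ).coeff π) =
        if π.IsCycleOn Set.univ then P.coeff c else 0 := fun π => by
    simp only [mul_left_comm _ (P.coeff π⁻¹)]
    rw [← mul_sum]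
    split_ifs with hπ
    · rw [sum_coeff_hookElement_of_isCycleOn K hπ, hcoeff π hπ, mul_one]
    · rw [sum_coeff_hookElement_of_not_isCycleOn K hπ, mul_zero]
  simp only [coeff_mul_one, mul_sum]
  rw [sum_comm, sum_congr rfl fun π _ => hterm π, ← sum_filter, sum_const, nsmul_eq_mul]

theorem card_mul_coeff (h : HasHookEigenvalues P Λ) {c : Perm α} (hc : c.IsCycleOn Set.univ)
    {m : ℕ} (hm : Fintype.card α = m + 1)
    [DecidablePred fun π : Perm α => π.IsCycleOn Set.univ] :
    ((m + 1 : ℕ) : K) * (#{π : Perm α | π.IsCycleOn Set.univ} * P.coeff c) =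
      ∑ r ∈ range (m + 1), (-1) ^ r * (m.choose r : K) * Λ r := by
  obtain ⟨i⟩ : Nonempty α := Fintype.card_pos_iff.1 (hm ▸ m.succ_pos)
  have hcard : #(univ.erase i) = m := by rw [card_erase_of_mem (mem_univ i), card_univ, hm]; rfl
  have hpowerset : ({S | i ∉ S} : Finset (Finset α)) = (univ.erase i).powerset := by
    ext S
    simp [subset_erase]
  rw [← h.sum_coeff_mul_hookElement hc i, mul_sum, ← sum_choose_hook_telescope, ← hcard,
    ← sum_powerset_apply_card, hpowerset, hcard]
  refine sum_congr rfl fun S _ => ?_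
  rw [mul_left_comm, ← hm, card_mul_coeff_mul_hookElement_compl h]

end HasHookEigenvalues

theorem hookContent_zero_one (n : ℕ) : hookContent n 0 (1 : K) = n.factorial := by
  rw [hookContent, ← prod_range_add_one_eq_factorial, Nat.cast_prod]
  exact prod_congr rfl fun l _ => by push_cast; ring

theorem hookContent_succ_one {n r : ℕ} (hr : r < n) : hookContent n (r + 1) (1 : K) = 0 :=
  prod_eq_zero (mem_range.2 hr) (by push_cast; ring)

theorem HasHookEigenvalues.factorial_mul_coeff [CharZero K] {m : ℕ}
    {P : MonoidAlgebra K (Perm (Fin (m + 1)))} {Λ : ℕ → K} (h : HasHookEigenvalues P Λ)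
    {c : Perm (Fin (m + 1))} (hc : c.IsCycleOn Set.univ) :
    ((m + 1).factorial : K) * P.coeff c =
      ∑ r ∈ range (m + 1), (-1) ^ r * (m.choose r : K) * Λ r := by
  classical
  have hcount :=
    (hasHookEigenvalues_cycleSum (m + 1) (1 : K)).card_mul_coeff hc (Fintype.card_fin _)
  rw [sum_range_succ', sum_eq_zero fun r hr => by
    rw [hookContent_succ_one ((mem_range.1 hr).trans m.lt_succ_self), mul_zero],
    hookContent_zero_one, cycleSum, coeff_sum_smul_of] at hcount
  simp only [one_pow, mul_one, pow_zero, Nat.choose_zero_right, Nat.cast_one, one_mul,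
    zero_add] at hcount
  rw [← h.card_mul_coeff hc (Fintype.card_fin _), ← mul_assoc, hcount]

end HookEigenvalues

/-! ### Coxeter elements -/

section Monomial

variable {d n : ℕ}

theorem monomialMatrix_mulVec (π : Perm (Fin n)) (a : Fin n → rootsOfUnity d ℂ) (v : Fin n → ℂ)
    (j : Fin n) : (monomialMatrix π a).mulVec v (π j) = ((a j : ℂˣ) : ℂ) * v j := by
  rw [Matrix.mulVec, dotProduct, sum_eq_single j]
  · simp [monomialMatrix]
  · intro b _ hb
    simp [monomialMatrix, hb.symm]
  · simp

theorem fixedSpace_eq_fixedVectors {g : GL (Fin n) ℂ} {π : Perm (Fin n)}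
    {a : Fin n → rootsOfUnity d ℂ} (hg : (g : Matrix (Fin n) (Fin n) ℂ) = monomialMatrix π a) :
    fixedSpace g = fixedVectors π fun i => (a i : ℂˣ) := by
  ext v
  rw [fixedSpace, LinearMap.mem_eqLocus, mem_fixedVectors, Matrix.toLin'_apply, hg,
    LinearMap.id_apply, funext_iff, ← π.forall_congr_right]
  simp only [monomialMatrix_mulVec]
  exact forall_congr' fun j => eq_comm

theorem hasEigenvector_iff_of_eq_monomialMatrix {g : GL (Fin n) ℂ} {π : Perm (Fin n)}
    {a : Fin n → rootsOfUnity d ℂ} (hg : (g : Matrix (Fin n) (Fin n) ℂ) = monomialMatrix π a)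
    {μ : ℂ} {v : Fin n → ℂ} :
    Module.End.HasEigenvector (Matrix.toLin' (g : Matrix (Fin n) (Fin n) ℂ)) μ v ↔
      (∀ j, ((a j : ℂˣ) : ℂ) * v j = μ * v (π j)) ∧ v ≠ 0 := by
  rw [Module.End.hasEigenvector_iff, Module.End.mem_eigenspace_iff, Matrix.toLin'_apply, hg,
    funext_iff, ← π.forall_congr_right]
  simp only [monomialMatrix_mulVec, Pi.smul_apply, smul_eq_mul]

/-- The generalized permutation matrix `[π; a]` as an element of the general linear group. -/
def monomialGL (π : Perm (Fin n)) (a : Fin n → rootsOfUnity d ℂ) : GL (Fin n) ℂ where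
  val := monomialMatrix π a
  inv := monomialMatrix π⁻¹ fun j => (a (π⁻¹ j))⁻¹
  val_inv := by
    rw [monomialMatrix_mul]
    simpa using monomialMatrix_one
  inv_val := by
    rw [monomialMatrix_mul]
    simpa using monomialMatrix_one

theorem coe_monomialGL (π : Perm (Fin n)) (a : Fin n → rootsOfUnity d ℂ) :
    (monomialGL π a : Matrix (Fin n) (Fin n) ℂ) = monomialMatrix π a := rfl

theorem monomialGL_mem (π : Perm (Fin n)) (a : Fin n → rootsOfUnity d ℂ) :
    monomialGL π a ∈ Gd1n d n := ⟨π, a, rfl⟩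

end Monomial

section ReflectingHyperplanes

theorem fixedVectors_one_mulSingle {K α : Type*} [Field K] [DecidableEq α] (i : α) {ζ : Kˣ}
    (hζ : ζ ≠ 1) : fixedVectors 1 (Pi.mulSingle i ζ) = LinearMap.ker (LinearMap.proj i) := by
  ext w
  rw [mem_fixedVectors, LinearMap.mem_ker, LinearMap.proj_apply]
  constructor
  · intro hw
    by_contra hwi
    have hi := hw i
    rw [Pi.mulSingle_eq_same, Perm.one_apply, right_eq_mul₀ hwi] at hi
    exact hζ (Units.ext hi)
  · intro hw j
    obtain rfl | hj := eq_or_ne j i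
    · simp [hw]
    · simp [Pi.mulSingle_eq_of_ne hj]

theorem coe_mulSingle {G α : Type*} [Group G] [DecidableEq α] {U : Subgroup G} (i : α) (ζ : U)
    (j : α) : (((Pi.mulSingle i ζ : α → U) j : U) : G) = (Pi.mulSingle i (ζ : G) : α → G) j :=
  Pi.apply_mulSingle (fun _ => Subtype.val) (fun _ => rfl) i ζ j

theorem fixedVectors_swap {K α : Type*} [Field K] [DecidableEq α] {i j : α} (hij : i ≠ j)
    (ξ : Kˣ) : fixedVectors (swap i j) (Pi.mulSingle i ξ⁻¹ * Pi.mulSingle j ξ) =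
      LinearMap.ker (LinearMap.proj i - (ξ : K) • LinearMap.proj j) := by
  ext w
  simp only [mem_fixedVectors, LinearMap.mem_ker, LinearMap.sub_apply, LinearMap.smul_apply,
    LinearMap.proj_apply, smul_eq_mul, sub_eq_zero]
  refine ⟨fun hw => by simpa [Pi.mulSingle_eq_of_ne hij.symm] using hw j, fun hw l => ?_⟩
  obtain rfl | hlj := eq_or_ne l j
  · simpa [Pi.mulSingle_eq_of_ne hij.symm] using hw
  obtain rfl | hli := eq_or_ne l i
  · simp [Pi.mulSingle_eq_of_ne hlj, hw]
  · simp [Pi.mulSingle_eq_of_ne hlj, Pi.mulSingle_eq_of_ne hli, swap_apply_of_ne_of_ne hli hlj]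

theorem isReflection_of_fixedSpace_eq_ker {n : ℕ} {g : GL (Fin n) ℂ}
    {f : Module.Dual ℂ (Fin n → ℂ)} (hf : f ≠ 0) (h : fixedSpace g = LinearMap.ker f) :
    IsReflection g := by
  rw [IsReflection, fixDim, h, Module.Dual.finrank_ker_add_one_of_ne_zero hf]
  simp

/-- The coordinates of `v` are nonzero with distinct `d`-th powers: `v` lies on no reflecting
hyperplane of `G(d, 1, n)`. -/
def IsGeneric {n : ℕ} (d : ℕ) (v : Fin n → ℂ) : Prop :=
  (∀ i, v i ≠ 0) ∧ Function.Injective fun i => v i ^ d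

variable {d n : ℕ} {v : Fin n → ℂ}

theorem coe_rootsOfUnity_pow (ζ : rootsOfUnity d ℂ) : ((ζ : ℂˣ) : ℂ) ^ d = 1 := by
  rw [← Units.val_pow_eq_pow_val, (mem_rootsOfUnity d _).1 ζ.2, Units.val_one]

theorem apply_ne_zero_of_notMem_fixedSpace (hd : 1 < d)
    (h : ∀ r ∈ Gd1n d n, IsReflection r → v ∉ fixedSpace r) (i : Fin n) : v i ≠ 0 := by
  have : NeZero d := ⟨by omega⟩
  obtain ⟨ζ, hζ⟩ : ∃ ζ : rootsOfUnity d ℂ, ζ ≠ 1 := by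
    have : Nontrivial (rootsOfUnity d ℂ) := by
      rwa [← Finite.one_lt_card_iff_nontrivial, Complex.card_rootsOfUnity]
    exact exists_ne 1
  have hker : fixedSpace (monomialGL 1 (Pi.mulSingle i ζ)) =
      LinearMap.ker (LinearMap.proj i : Module.Dual ℂ (Fin n → ℂ)) := by
    rw [fixedSpace_eq_fixedVectors (coe_monomialGL _ _),
      ← fixedVectors_one_mulSingle i (ζ := ζ) (by simpa using hζ)]
    simp only [coe_mulSingle]
  have hproj : (LinearMap.proj i : Module.Dual ℂ (Fin n → ℂ)) ≠ 0 := fun h0 => by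
    simpa using LinearMap.congr_fun h0 (Pi.single i 1)
  have hv := h _ (monomialGL_mem _ _) (isReflection_of_fixedSpace_eq_ker hproj hker)
  rwa [hker] at hv

theorem isGeneric_of_notMem_fixedSpace (hd : 1 < d)
    (h : ∀ r ∈ Gd1n d n, IsReflection r → v ∉ fixedSpace r) : IsGeneric d v := by
  have h0 := apply_ne_zero_of_notMem_fixedSpace hd h
  have : NeZero d := ⟨by omega⟩
  refine ⟨h0, fun i j hij => by_contra fun hne => ?_⟩
  have hpow : (v i / v j) ^ d = 1 := by
    rw [div_pow, div_eq_one_iff_eq (pow_ne_zero _ (h0 j))]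
    exact hij
  obtain ⟨ξ, hξ⟩ : ∃ ξ : rootsOfUnity d ℂ, ((ξ : ℂˣ) : ℂ) = v i / v j :=
    ⟨rootsOfUnity.mkOfPowEq _ hpow, rootsOfUnity.coe_mkOfPowEq hpow⟩
  have hker : fixedSpace (monomialGL (swap i j) (Pi.mulSingle i ξ⁻¹ * Pi.mulSingle j ξ)) =
      LinearMap.ker (LinearMap.proj i - ((ξ : ℂˣ) : ℂ) • LinearMap.proj j :
        Module.Dual ℂ (Fin n → ℂ)) := by
    rw [fixedSpace_eq_fixedVectors (coe_monomialGL _ _), ← fixedVectors_swap hne]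
    simp only [Pi.mul_apply, Subgroup.coe_mul, coe_mulSingle, InvMemClass.coe_inv]
    rfl
  have hform : (LinearMap.proj i - ((ξ : ℂˣ) : ℂ) • LinearMap.proj j :
      Module.Dual ℂ (Fin n → ℂ)) ≠ 0 := fun h0 => by
    simpa [hne] using LinearMap.congr_fun h0 (Pi.single i 1)
  refine h _ (monomialGL_mem _ _) (isReflection_of_fixedSpace_eq_ker hform hker) ?_
  rw [hker, LinearMap.mem_ker]
  simp [hξ, h0 j]

theorem IsGeneric.eq_one (hv : IsGeneric d v) {σ : Perm (Fin n)} {b : Fin n → rootsOfUnity d ℂ}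
    (h : v ∈ fixedVectors σ fun i => (b i : ℂˣ)) : σ = 1 ∧ b = 1 := by
  rw [mem_fixedVectors] at h
  obtain rfl : σ = 1 := by
    ext j
    rw [hv.2 (a₁ := σ j) (a₂ := j) (by simp only [h j, mul_pow, coe_rootsOfUnity_pow, one_mul])]
    rfl
  refine ⟨rfl, funext fun j => ?_⟩
  have hj := h j
  rw [Perm.one_apply, right_eq_mul₀ (hv.1 j)] at hj
  exact Subtype.ext (Units.ext hj)

theorem IsGeneric.notMem_fixedSpace (hv : IsGeneric d v) {r : GL (Fin n) ℂ} (hr : r ∈ Gd1n d n)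
    (hrefl : IsReflection r) : v ∉ fixedSpace r := by
  intro hmem
  obtain ⟨σ, b, hσ⟩ := hr
  rw [fixedSpace_eq_fixedVectors hσ] at hmem
  obtain ⟨rfl, rfl⟩ := hv.eq_one hmem
  obtain rfl : r = 1 := Units.ext (hσ.trans monomialMatrix_one)
  have htop : fixedSpace (1 : GL (Fin n) ℂ) = ⊤ := by
    rw [fixedSpace, Units.val_one, Matrix.toLin'_one, LinearMap.eqLocus_same]
  rw [IsReflection, fixDim, htop, finrank_top, Module.finrank_fin_fun] at hrefl
  omega

end ReflectingHyperplanes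

section CoxeterElements

variable {d n : ℕ}

theorem isGeneric_primitiveRoot_pow {μ : ℂ} (hd : 0 < d) (hμ : IsPrimitiveRoot μ (d * n)) :
    IsGeneric d fun j : Fin n => μ ^ (j : ℕ) := by
  refine ⟨fun i => pow_ne_zero _ (hμ.ne_zero (mul_pos hd i.pos).ne'), fun i j hij => ?_⟩
  simp only [← pow_mul] at hij
  have hlt : ∀ l : Fin n, (l : ℕ) * d < d * n := fun l => by
    rw [mul_comm d]; exact Nat.mul_lt_mul_of_pos_right l.2 hd
  exact Fin.ext (Nat.eq_of_mul_eq_mul_right hd (hμ.pow_inj (hlt i) (hlt j) hij))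

theorem isRegularNumber_mul (hd : 0 < d) (hn : 0 < n) : IsRegularNumber (Gd1n d n) (d * n) := by
  obtain ⟨m, rfl⟩ := Nat.exists_eq_add_one.2 hn
  have hdn : d * (m + 1) ≠ 0 := by positivity
  have hμ := Complex.isPrimitiveRoot_exp _ hdn
  set μ : ℂ := Complex.exp (2 * Real.pi * Complex.I / (d * (m + 1) : ℕ))
  have hμ0 : μ ≠ 0 := hμ.ne_zero hdn
  have : NeZero d := ⟨hd.ne'⟩
  have hpow : (μ ^ (m + 1)) ^ d = 1 := by rw [← pow_mul, mul_comm, hμ.pow_eq_one]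
  obtain ⟨ξ, hξ⟩ : ∃ ξ : rootsOfUnity d ℂ, ((ξ : ℂˣ) : ℂ) = μ ^ (m + 1) :=
    ⟨rootsOfUnity.mkOfPowEq _ hpow, rootsOfUnity.coe_mkOfPowEq hpow⟩
  have hv := isGeneric_primitiveRoot_pow hd hμ.inv
  refine ⟨monomialGL (finRotate (m + 1)) (Pi.mulSingle (Fin.last m) ξ), monomialGL_mem _ _, μ, _,
    ⟨(hasEigenvector_iff_of_eq_monomialMatrix (coe_monomialGL _ _)).2
      ⟨fun j => ?_, fun h0 => hv.1 0 (congrFun h0 0)⟩,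
      fun r hr hrefl => hv.notMem_fixedSpace hr hrefl⟩, hμ⟩
  refine Fin.lastCases ?_ (fun l => ?_) j
  · rw [Pi.mulSingle_eq_same, finRotate_last, hξ]
    simp [pow_succ', hμ0]
  · rw [Pi.mulSingle_eq_of_ne (Fin.castSucc_lt_last l).ne, finRotate_apply, Fin.coeSucc_eq_succ]
    simp [pow_succ', hμ0]

theorem IsGeneric.pow_eq_one {v : Fin n → ℂ} (hv : IsGeneric d v) {c : GL (Fin n) ℂ}
    (hc : c ∈ Gd1n d n) {μ : ℂ}
    (hev : Module.End.HasEigenvector (Matrix.toLin' (c : Matrix (Fin n) (Fin n) ℂ)) μ v) {k : ℕ}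
    (hμ : μ ^ k = 1) : c ^ k = 1 := by
  obtain ⟨σ, b, hσ⟩ := pow_mem hc k
  have hfix : v ∈ fixedSpace (c ^ k) := by
    rw [fixedSpace, LinearMap.mem_eqLocus, Units.val_pow_eq_pow_val, Matrix.toLin'_pow,
      hev.pow_apply, hμ, one_smul, LinearMap.id_apply]
  rw [fixedSpace_eq_fixedVectors hσ] at hfix
  obtain ⟨rfl, rfl⟩ := hv.eq_one hfix
  exact Units.ext (hσ.trans monomialMatrix_one)

theorem pow_card_eq_prod {K α : Type*} [Field K] {π : Perm α} {a v : α → K} {μ : K}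
    (h : ∀ j, a j * v j = μ * v (π j)) (hv : ∀ i, v i ≠ 0) {A : Finset α}
    (hA : ∀ i, π i ∈ A ↔ i ∈ A) : μ ^ #A = ∏ i ∈ A, a i := by
  have hperm : ∏ j ∈ A, v (π j) = ∏ j ∈ A, v j :=
    prod_equiv π (fun i => (hA i).symm) fun _ _ => rfl
  refine mul_right_cancel₀ (prod_ne_zero_iff.2 fun j (_ : j ∈ A) => hv j) ?_
  rw [← prod_mul_distrib, prod_congr rfl fun j _ => h j, prod_mul_distrib, prod_const, hperm]

theorem IsCoxeterElement.exists_eq_monomialMatrix (hd : 1 < d) {c : GL (Fin n) ℂ}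
    (hc : IsCoxeterElement (Gd1n d n) c) :
    ∃ (π : Perm (Fin n)) (a : Fin n → rootsOfUnity d ℂ),
      (c : Matrix (Fin n) (Fin n) ℂ) = monomialMatrix π a ∧ π.IsCycleOn Set.univ ∧
        ∏ i, a i ≠ 1 := by
  obtain ⟨⟨hcG, μ, v, hev, hreg⟩, hcox⟩ := hc
  have hv := isGeneric_of_notMem_fixedSpace hd hreg
  obtain ⟨π, a, hπ⟩ := id hcG
  have hstep := ((hasEigenvector_iff_of_eq_monomialMatrix hπ).1 hev)
  obtain ⟨i, -⟩ := Function.ne_iff.1 hstep.2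
  have horder : ∀ k, 0 < k → μ ^ k = 1 → d * n ≤ k := fun k hk hμk =>
    (hcox.2 (isRegularNumber_mul (by omega) i.pos)).trans
      (orderOf_le_of_pow_eq_one hk (hv.pow_eq_one hcG hev hμk))
  have hpow : ∀ A : Finset (Fin n), (∀ i, π i ∈ A ↔ i ∈ A) →
      μ ^ #A = ((∏ i ∈ A, a i : rootsOfUnity d ℂ) : ℂˣ) := fun A hA => by
    rw [pow_card_eq_prod hstep.1 hv.1 hA]
    push_cast
    rfl
  refine ⟨π, a, hπ, ⟨Set.bijOn_univ.2 π.bijective, fun x _ y _ => ?_⟩, fun hprod => ?_⟩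
  · by_contra hxy
    have hlt : #(orbitFinset π x) < n := by
      simpa using card_lt_univ_of_notMem fun h => hxy (mem_orbitFinset.1 h)
    have hpos : 0 < #(orbitFinset π x) :=
      card_pos.2 ⟨x, mem_orbitFinset.2 (Perm.SameCycle.refl _ _)⟩
    have hle := horder (d * #(orbitFinset π x)) (by positivity) (by
      rw [mul_comm, pow_mul, hpow _ fun _ => apply_mem_orbitFinset, coe_rootsOfUnity_pow])
    exact hlt.not_ge (Nat.le_of_mul_le_mul_left hle (by omega))
  · have hμn := hpow univ (by simp)
    rw [hprod, card_univ, Fintype.card_fin] at hμn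
    exact (horder n i.pos (by simpa using hμn)).not_gt (lt_mul_of_one_lt_left i.pos hd)

end CoxeterElements

/-! ### Factorization sums -/

section Coordinates

variable {d n : ℕ}

theorem monomialMatrix_injective {π σ : Perm (Fin n)} {a b : Fin n → rootsOfUnity d ℂ}
    (h : monomialMatrix π a = monomialMatrix σ b) : π = σ ∧ a = b := by
  have hentry : ∀ j, π j = σ j ∧ a j = b j := fun j => by
    have hj := congrFun (congrFun h (π j)) j
    simp only [monomialMatrix, Matrix.of_apply, if_true] at hj
    split_ifs at hj with hπσ
    · exact ⟨hπσ, Subtype.ext (Units.ext hj)⟩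
    · exact absurd hj (Units.ne_zero _)
  exact ⟨Equiv.ext fun j => (hentry j).1, funext fun j => (hentry j).2⟩

/-- Coordinates on `G(d, 1, n)`: the underlying permutation and the nonzero entries. -/
def gdEquiv (d n : ℕ) : Perm (Fin n) × (Fin n → rootsOfUnity d ℂ) ≃ Gd1n d n :=
  Equiv.ofBijective (fun p => ⟨monomialGL p.1 p.2, monomialGL_mem p.1 p.2⟩) <| by
    refine ⟨fun ⟨π, a⟩ ⟨σ, b⟩ h => ?_, fun ⟨g, π, a, hg⟩ =>
      ⟨(π, a), Subtype.ext (Units.ext hg.symm)⟩⟩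
    obtain ⟨rfl, rfl⟩ := monomialMatrix_injective (congrArg Units.val (Subtype.ext_iff.1 h))
    rfl

theorem gdEquiv_one : gdEquiv d n (1, 1) = 1 := Subtype.ext (Units.ext monomialMatrix_one)

theorem gdEquiv_mul (π σ : Perm (Fin n)) (a b : Fin n → rootsOfUnity d ℂ) :
    gdEquiv d n (π, a) * gdEquiv d n (σ, b) = gdEquiv d n (π * σ, fun j => a (σ j) * b j) :=
  Subtype.ext (Units.ext (monomialMatrix_mul π σ a b))

theorem fixDim_gdEquiv (π : Perm (Fin n)) (a : Fin n → rootsOfUnity d ℂ) :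
    fixDim (gdEquiv d n (π, a) : GL (Fin n) ℂ) =
      Module.finrank ℂ (fixedVectors π fun i => (a i : ℂˣ)) := by
  rw [fixDim]
  exact congrArg (fun V : Submodule ℂ (Fin n → ℂ) => Module.finrank ℂ V)
    (fixedSpace_eq_fixedVectors (coe_monomialGL π a))

/-- The homomorphism `[π; a] ↦ χ (∏ a) • π` to the group algebra of the symmetric group. -/
def twistHom (n : ℕ) (χ : rootsOfUnity d ℂ →* ℂ) : Gd1n d n →* MonoidAlgebra ℂ (Perm (Fin n)) where
  toFun g := χ (∏ i, ((gdEquiv d n).symm g).2 i) • of ℂ _ ((gdEquiv d n).symm g).1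
  map_one' := by
    rw [← gdEquiv_one, symm_apply_apply]
    simp [MonoidAlgebra.one_def]
  map_mul' g h := by
    obtain ⟨⟨π, a⟩, rfl⟩ := (gdEquiv d n).surjective g
    obtain ⟨⟨σ, b⟩, rfl⟩ := (gdEquiv d n).surjective h
    simp only [gdEquiv_mul, symm_apply_apply, prod_mul_distrib, σ.prod_comp univ a (by simp),
      map_mul, smul_mul_smul_comm]

theorem twistHom_gdEquiv (χ : rootsOfUnity d ℂ →* ℂ) (π : Perm (Fin n))
    (a : Fin n → rootsOfUnity d ℂ) :
    twistHom n χ (gdEquiv d n (π, a)) = χ (∏ i, a i) • of ℂ _ π := by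
  simp [twistHom]

variable [NeZero d]

instance : Fintype (rootsOfUnity d ℂ) := Fintype.ofFinite _

instance : Fintype (Gd1n d n) := Fintype.ofEquiv _ (gdEquiv d n)

theorem fintypeCard_rootsOfUnity : Fintype.card (rootsOfUnity d ℂ) = d := by
  rw [← Nat.card_eq_fintype_card, Complex.card_rootsOfUnity]

theorem card_Gd1n : Fintype.card (Gd1n d n) = d ^ n * n.factorial := by
  rw [← Fintype.card_congr (gdEquiv d n), Fintype.card_prod, Fintype.card_perm, Fintype.card_fun,
    fintypeCard_rootsOfUnity, Fintype.card_fin, mul_comm]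

theorem sum_smul_twistHom (χ : rootsOfUnity d ℂ →* ℂ) (f : Gd1n d n → ℂ) :
    ∑ g, f g • twistHom n χ g = ∑ π : Perm (Fin n),
      (∑ a : Fin n → rootsOfUnity d ℂ, χ (∏ i, a i) * f (gdEquiv d n (π, a))) • of ℂ _ π := by
  rw [← (gdEquiv d n).sum_comp, Fintype.sum_prod_type]
  simp only [twistHom_gdEquiv, sum_smul, smul_smul, mul_comm]

theorem sum_pow_fixDim_smul_twistHom (χ : rootsOfUnity d ℂ →* ℂ) {x y : ℂ}
    (hy : d * y = x - 1 + ∑ ζ, χ ζ) :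
    ∑ g : Gd1n d n, x ^ fixDim (g : GL (Fin n) ℂ) • twistHom n χ g = (d : ℂ) ^ n • cycleSum y := by
  rw [sum_smul_twistHom, cycleSum, smul_sum]
  refine sum_congr rfl fun π _ => ?_
  have htwisted := twistedSum_eq χ x (by rwa [fintypeCard_rootsOfUnity]) π
  rw [twistedSum, fintypeCard_rootsOfUnity] at htwisted
  simp only [fixDim_gdEquiv, htwisted, smul_smul]

end Coordinates

section WeightedCount

theorem list_prod_ofFn_sum {R G A : Type*} [CommSemiring R] [Monoid G] [Fintype G] [Semiring A]
    [Algebra R A] (φ : G →* A) {k : ℕ} (f : Fin k → G → R) :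
    (List.ofFn fun i => ∑ g, f i g • φ g).prod =
      ∑ u : Fin k → G, (∏ i, f i (u i)) • φ (List.ofFn u).prod := by
  induction k with
  | zero => simp
  | succ k ih =>
    rw [List.ofFn_succ, List.prod_cons, ih fun i => f i.succ, sum_mul_sum,
      ← (Fin.consEquiv fun _ => G).sum_comp, Fintype.sum_prod_type]
    refine sum_congr rfl fun g _ => sum_congr rfl fun u _ => ?_
    rw [smul_mul_smul_comm, ← map_mul]
    simp [Fin.consEquiv, Fin.prod_univ_succ, List.ofFn_succ]

variable {d n k : ℕ} [NeZero d]

open Classical in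
/-- The generating function of the factorizations of `g` into `k` factors by the fixed space
dimensions of the factors, evaluated at `x`. -/
def weightedCount (x : Fin k → ℂ) (g : Gd1n d n) : ℂ :=
  ∑ u : Fin k → Gd1n d n with (List.ofFn u).prod = g, ∏ i, x i ^ fixDim (u i : GL (Fin n) ℂ)

theorem sum_weightedCount_smul {A : Type*} [Semiring A] [Algebra ℂ A] (φ : Gd1n d n →* A)
    (x : Fin k → ℂ) :
    ∑ g, weightedCount x g • φ g =
      (List.ofFn fun i => ∑ g : Gd1n d n, x i ^ fixDim (g : GL (Fin n) ℂ) • φ g).prod := by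
  classical
  rw [list_prod_ofFn_sum φ, ← sum_fiberwise (s := univ) (g := fun u => (List.ofFn u).prod)]
  refine sum_congr rfl fun g _ => ?_
  rw [weightedCount, sum_smul]
  refine sum_congr (by congr!) fun u hu => ?_
  rw [(mem_filter.1 hu).2]

theorem sum_char_mul_weightedCount (χ : rootsOfUnity d ℂ →* ℂ) {x y : Fin k → ℂ}
    (hy : ∀ i, d * y i = x i - 1 + ∑ ζ, χ ζ) (π : Perm (Fin n)) :
    ∑ a : Fin n → rootsOfUnity d ℂ, χ (∏ i, a i) * weightedCount x (gdEquiv d n (π, a)) =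
      ((d : ℂ) ^ n) ^ k * (List.ofFn fun i => cycleSum (y i)).prod.coeff π := by
  have hsum := sum_weightedCount_smul (twistHom n χ) x
  simp only [fun i => sum_pow_fixDim_smul_twistHom (n := n) χ (hy i)] at hsum
  have hscalars := List.smul_prod (List.ofFn fun i => (cycleSum (y i) : MonoidAlgebra ℂ
    (Perm (Fin n)))) ((d : ℂ) ^ n)
  rw [List.length_ofFn, List.map_ofFn] at hscalars
  rw [← coeff_sum_smul_of (fun σ => ∑ a : Fin n → rootsOfUnity d ℂ,
    χ (∏ i, a i) * weightedCount x (gdEquiv d n (σ, a))) π, ← sum_smul_twistHom, hsum,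
    ← smul_eq_mul, ← MonoidAlgebra.coeff_smul_apply, hscalars]
  rfl

theorem fixDim_conj (g u : GL (Fin n) ℂ) : fixDim (g * u * g⁻¹) = fixDim u := by
  let e := Matrix.toLin'OfInv (congrArg Units.val (mul_inv_cancel g))
    (congrArg Units.val (inv_mul_cancel g))
  have he : ∀ v, e v = ((g⁻¹ : GL (Fin n) ℂ) : Matrix (Fin n) (Fin n) ℂ).mulVec v := fun _ => rfl
  have hcomap : fixedSpace (g * u * g⁻¹) = (fixedSpace u).comap (e : _ →ₗ[ℂ] _) := by
    ext v
    rw [Submodule.mem_comap, fixedSpace, fixedSpace, LinearMap.mem_eqLocus, LinearMap.mem_eqLocus,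
      ← e.injective.eq_iff]
    simp only [LinearEquiv.coe_coe, he, Matrix.toLin'_apply, LinearMap.id_apply,
      Matrix.mulVec_mulVec, ← Units.val_mul]
    rw [mul_assoc g, inv_mul_cancel_left]
  rw [fixDim, hcomap, fixDim]
  exact LinearEquiv.finrank_eq (LinearEquiv.ofSubmodule' _ _)

theorem weightedCount_conj (x : Fin k → ℂ) (g u : Gd1n d n) :
    weightedCount x (g * u * g⁻¹) = weightedCount x u := by
  have hcomm : Commute (of ℂ _ g) (∑ g, weightedCount x g • of ℂ (Gd1n d n) g) := by
    rw [sum_weightedCount_smul]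
    refine Commute.list_prod_right _ _ fun z hz => ?_
    obtain ⟨i, rfl⟩ := List.mem_ofFn.1 hz
    refine commute_of_iff.2 fun u => ?_
    rw [coeff_sum_smul_of, coeff_sum_smul_of]
    exact congrArg (x i ^ ·) (fixDim_conj _ _)
  simpa only [coeff_sum_smul_of] using commute_of_iff.1 hcomm u

end WeightedCount

/-! ### Character sums -/

section CharacterInversion

variable {U : Type*} [CommGroup U] [Fintype U]

theorem card_mul_eq_sum_inv_mul_sum_mul (f : U → ℂ) (δ : U) :
    (Fintype.card U : ℂ) * f δ =
      ∑ ψ : AddChar (Additive U) ℂ, ψ (.ofMul δ⁻¹) * ∑ ζ : U, ψ (.ofMul ζ) * f ζ := by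
  classical
  simp only [mul_sum, ← mul_assoc, ← AddChar.map_add_eq_mul, ← ofMul_mul]
  rw [sum_comm]
  simp only [← sum_mul, AddChar.sum_apply_eq_ite, ofMul_eq_zero, inv_mul_eq_one,
    Fintype.card_additive, ite_mul, zero_mul, sum_ite_eq, mem_univ, if_true]

theorem card_mul_eq_sub_of_sum_char_mul {f : U → ℂ} {A B : ℂ} (hA : ∑ ζ, f ζ = A)
    (hB : ∀ χ : U →* ℂ, χ ≠ 1 → ∑ ζ, χ ζ * f ζ = B) {δ : U} (hδ : δ ≠ 1) :
    (Fintype.card U : ℂ) * f δ = A - B := by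
  classical
  have htransform : ∀ ψ : AddChar (Additive U) ℂ, ∑ ζ, ψ (.ofMul ζ) * f ζ =
      B + if ψ = 0 then A - B else 0 := fun ψ => by
    split_ifs with hψ
    · simp [hψ, hA]
    · rw [add_zero]
      let χ := ψ.toMonoidHom.comp (MulEquiv.multiplicativeAdditive U).symm.toMonoidHom
      exact hB χ fun hχ => hψ (DFunLike.ext _ _ fun ζ => DFunLike.congr_fun hχ ζ.toMul)
  rw [card_mul_eq_sum_inv_mul_sum_mul]
  simp only [htransform, mul_add, sum_add_distrib, ← sum_mul, AddChar.sum_apply_eq_ite]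
  simp [hδ]

end CharacterInversion

section CyclicConjugation

variable {α A : Type*} [Fintype α] [CommGroup A] {π : Perm α}

theorem prod_range_pow_apply_of_isCycleOn {M : Type*} [CommMonoid M]
    (hπ : π.IsCycleOn Set.univ) (x : α) (b : α → M) :
    ∏ i ∈ range (Fintype.card α), b ((π ^ i) x) = ∏ j, b j := by
  rw [← coe_univ] at hπ
  refine prod_nbij (fun i => (π ^ i) x) (fun _ _ => mem_univ _) (fun i hi j hj hij => ?_)
    (fun j _ => ?_) fun _ _ => rfl
  · rw [coe_range, Set.mem_Iio] at hi hj
    exact ((hπ.pow_apply_eq_pow_apply (mem_univ x)).1 hij).eq_of_lt_of_lt hi hj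
  · obtain ⟨i, hi, hij⟩ := hπ.exists_pow_eq (mem_univ x) (mem_univ j)
    exact ⟨i, mem_coe.2 (mem_range.2 hi), hij⟩

theorem exists_apply_eq_mul_of_isCycleOn (hπ : π.IsCycleOn Set.univ) {b : α → A}
    (hb : ∏ i, b i = 1) : ∃ t : α → A, ∀ j, t (π j) = b j * t j := by
  rcases isEmpty_or_nonempty α with hα | ⟨⟨x⟩⟩
  · exact ⟨1, fun j => isEmptyElim j⟩
  rw [← coe_univ] at hπ
  choose l hl hlx using fun j => hπ.exists_pow_eq (mem_univ x) (mem_univ j)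
  refine ⟨fun j => ∏ i ∈ range (l j), b ((π ^ i) x), fun j => ?_⟩
  dsimp only
  have hmod : l (π j) ≡ l j + 1 [MOD #(univ : Finset α)] := by
    rw [← hπ.pow_apply_eq_pow_apply (mem_univ x), hlx, pow_succ', Perm.mul_apply, hlx]
  have hstep : b j * ∏ i ∈ range (l j), b ((π ^ i) x) =
      ∏ i ∈ range (l j + 1), b ((π ^ i) x) := by
    rw [prod_range_succ, hlx, mul_comm]
  rw [hstep]
  rcases (Nat.succ_le_of_lt (hl j)).lt_or_eq with hlt | heq
  · rw [hmod.eq_of_lt_of_lt (hl _) hlt]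
  · have hzero : l (π j) = 0 := Nat.ModEq.eq_of_lt_of_lt
      (hmod.trans (by rw [← Nat.succ_eq_add_one, heq]; simp [Nat.ModEq])) (hl _) (by omega)
    rw [hzero, ← Nat.succ_eq_add_one, heq, card_univ,
      prod_range_pow_apply_of_isCycleOn (by simpa using hπ), hb, range_zero, prod_empty]

end CyclicConjugation

section Fibers

variable {α U : Type*} [Fintype α] [DecidableEq α] [Nonempty α] [CommGroup U] [Fintype U]
  [DecidableEq U]

theorem card_mul_card_filter_prod_eq (δ : U) :
    Fintype.card U * #{a : α → U | ∏ i, a i = δ} = Fintype.card U ^ Fintype.card α := by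
  let p : (α → U) →* U := 
    { toFun := fun t => ∏ i, t i
      map_one' := by simp
      map_mul' := fun s t => by simp [prod_mul_distrib] }
  have hp : ∀ ζ, ζ ∈ Set.range p := fun ζ =>
    ⟨Pi.mulSingle (Classical.arbitrary α) ζ, by simp [p]⟩
  have hfiber : ∀ ζ, #{a | p a = ζ} = #{a | p a = δ} := fun ζ =>
    MonoidHom.card_fiber_eq_of_mem_range p (hp ζ) (hp δ)
  have htotal := card_eq_sum_card_fiberwise (s := univ) (t := univ) (f := p) fun _ _ => mem_univ _
  rw [sum_congr rfl fun ζ _ => hfiber ζ, sum_const, card_univ, card_univ, Fintype.card_fun,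
    smul_eq_mul] at htotal
  exact htotal.symm

end Fibers

section SingleCycle

variable {d n k : ℕ} [NeZero d] {π : Perm (Fin n)}

theorem weightedCount_eq_of_prod_eq (hπ : π.IsCycleOn Set.univ) (x : Fin k → ℂ)
    {a b : Fin n → rootsOfUnity d ℂ} (h : ∏ i, a i = ∏ i, b i) :
    weightedCount x (gdEquiv d n (π, a)) = weightedCount x (gdEquiv d n (π, b)) := by
  obtain ⟨t, ht⟩ := exists_apply_eq_mul_of_isCycleOn hπ (b := a / b)
    (by simp [prod_div_distrib, h])
  rw [← weightedCount_conj x (gdEquiv d n (1, t)) (gdEquiv d n (π, b))]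
  congr 1
  rw [eq_mul_inv_iff_mul_eq, gdEquiv_mul, gdEquiv_mul, mul_one, one_mul]
  congr 2
  funext j
  rw [ht j, Perm.one_apply, Pi.div_apply, mul_right_comm, div_mul_cancel]

theorem weightedCount_eq_coeff_sub_coeff (hπ : π.IsCycleOn Set.univ) {a : Fin n → rootsOfUnity d ℂ}
    (ha : ∏ i, a i ≠ 1) (z : Fin k → ℂ) :
    (d : ℂ) ^ n * weightedCount (fun i => 1 + d * z i) (gdEquiv d n (π, a)) =
      ((d : ℂ) ^ n) ^ k * ((List.ofFn fun i => cycleSum (z i + 1)).prod.coeff π -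
        (List.ofFn fun i => cycleSum (z i)).prod.coeff π) := by
  classical
  have : Nonempty (Fin n) := by
    by_contra hn
    rw [not_nonempty_iff] at hn
    exact ha (Fintype.prod_empty _)
  let f (ζ : rootsOfUnity d ℂ) : ℂ := ∑ b : Fin n → rootsOfUnity d ℂ with ∏ i, b i = ζ,
    weightedCount (fun i => 1 + d * z i) (gdEquiv d n (π, b))
  have hf : ∀ χ : rootsOfUnity d ℂ →* ℂ, ∑ ζ, χ ζ * f ζ = ∑ b : Fin n → rootsOfUnity d ℂ,
      χ (∏ i, b i) * weightedCount (fun i => 1 + d * z i) (gdEquiv d n (π, b)) := fun χ => by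
    rw [← sum_fiberwise (s := univ) (g := fun b : Fin n → rootsOfUnity d ℂ => ∏ i, b i)]
    refine sum_congr rfl fun ζ _ => ?_
    rw [mul_sum]
    refine sum_congr rfl fun b hb => ?_
    rw [(mem_filter.1 hb).2]
  have hδ : f (∏ i, a i) = #{b : Fin n → rootsOfUnity d ℂ | ∏ i, b i = ∏ i, a i} *
      weightedCount (fun i => 1 + d * z i) (gdEquiv d n (π, a)) := by
    rw [← nsmul_eq_mul, ← sum_const]
    exact sum_congr rfl fun b hb => weightedCount_eq_of_prod_eq hπ _ (mem_filter.1 hb).2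
  have hcard := congrArg (Nat.cast (R := ℂ))
    (card_mul_card_filter_prod_eq (α := Fin n) (∏ i, a i))
  push_cast at hcard
  rw [fintypeCard_rootsOfUnity, Fintype.card_fin] at hcard
  have hinversion := card_mul_eq_sub_of_sum_char_mul (f := f)
    (A := ((d : ℂ) ^ n) ^ k * (List.ofFn fun i => cycleSum (z i + 1)).prod.coeff π)
    (B := ((d : ℂ) ^ n) ^ k * (List.ofFn fun i => cycleSum (z i)).prod.coeff π) ?_ ?_ ha
  · rw [mul_sub, ← hinversion, hδ, fintypeCard_rootsOfUnity, ← mul_assoc, hcard]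
  · simpa using (hf 1).trans (sum_char_mul_weightedCount 1 (fun i => by
      simp [fintypeCard_rootsOfUnity, mul_add]) π)
  · intro χ hχ
    rw [hf, sum_char_mul_weightedCount χ fun i => ?_]
    rw [sum_hom_units, if_neg hχ]
    simp

end SingleCycle

/-! ### Binomial identities -/

section Binomials

theorem sum_alternating_choose_succ {R : Type*} [CommRing R] (m : ℕ) (f : ℕ → R) :
    ∑ t ∈ range (m + 2), (-1) ^ t * ((m + 1).choose t : R) * f t =
      ∑ t ∈ range (m + 1), (-1) ^ t * (m.choose t : R) * (f t - f (t + 1)) := by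
  have hshift : ∑ t ∈ range (m + 1), (-1) ^ t * (m.choose t : R) * f t =
      ∑ t ∈ range (m + 1), (-1) ^ (t + 1) * (m.choose (t + 1) : R) * f (t + 1) + f 0 := by
    rw [sum_range_succ', sum_range_succ fun t => (-1) ^ (t + 1) * (m.choose (t + 1) : R) *
      f (t + 1)]
    simp
  simp only [mul_sub, sum_sub_distrib]
  rw [hshift, sum_range_succ', add_sub_right_comm, ← sum_sub_distrib, pow_zero,
    Nat.choose_zero_right, Nat.cast_one, one_mul, one_mul]
  congr 1
  refine sum_congr rfl fun t _ => ?_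
  rw [Nat.choose_succ_succ', Nat.cast_add]
  ring

theorem sum_alternating_choose_mul_choose {n p q : ℕ} (hp : p ≤ n) (hq : q ≤ n) :
    ∑ t ∈ range (p + 1), (-1) ^ t * (p.choose t : ℤ) * ((n - t).choose (n - q) : ℤ) =
      (n - p).choose q := by
  induction p generalizing n with
  | zero => simp [Nat.choose_symm hq]
  | succ p ih =>
    obtain ⟨n, rfl⟩ : ∃ l, n = l + 1 := ⟨n - 1, by omega⟩
    rw [sum_alternating_choose_succ, Nat.add_sub_add_right]
    rcases hq.eq_or_lt with rfl | hq
    · rw [Nat.choose_eq_zero_of_lt (by omega)]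
      simp
    · rw [← ih (by omega) (Nat.lt_succ_iff.1 hq)]
      refine sum_congr rfl fun t ht => ?_
      have htp := mem_range.1 ht
      rw [Nat.add_sub_add_right, show n + 1 - t = n - t + 1 by omega,
        show n + 1 - q = n - q + 1 by omega, Nat.choose_succ_succ']
      push_cast
      ring

theorem sum_choose_mul_choose {n t : ℕ} (ht : t ≤ n) (z : ℕ) :
    ∑ p ∈ range (n + 1), (n - t).choose (n - p) * z.choose p = (z + n - t).choose n := by
  rw [Nat.add_sub_assoc ht, Nat.add_choose_eq,
    Nat.sum_antidiagonal_eq_sum_range_succ fun i j => z.choose i * (n - t).choose j]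
  exact sum_congr rfl fun p _ => mul_comm _ _

theorem trinomial_eq (n p q : ℕ) : trinomial n p q = n.choose p * (n - p).choose q := by
  rw [trinomial]
  split_ifs with h
  · have hp := Nat.choose_mul_factorial_mul_factorial (show p ≤ n by omega)
    have hq := Nat.choose_mul_factorial_mul_factorial (show q ≤ n - p by omega)
    rw [Nat.multinomial_univ_three, show p + q + (n - p - q) = n by omega]
    refine Nat.div_eq_of_eq_mul_left (by positivity) ?_
    rw [← hp, ← hq]
    ring
  · rcases lt_or_ge n p with hp | hp
    · rw [Nat.choose_eq_zero_of_lt hp, zero_mul]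
    · rw [Nat.choose_eq_zero_of_lt (show n - p < q by omega), mul_zero]

end Binomials

section Mcoeff

variable {n k : ℕ} {p : Fin k → ℕ}

theorem Mcoeff_eq_zero {i : Fin k} (hi : n < p i) : Mcoeff n p = 0 := by
  refine sum_eq_zero fun t _ => ?_
  rcases lt_or_ge n t with ht | ht
  · rw [Nat.choose_eq_zero_of_lt ht]
    simp
  · rw [prod_eq_zero (mem_univ i) (by rw [Nat.choose_eq_zero_of_lt (by omega), Nat.cast_zero]),
      mul_zero]

theorem Mcoeff_eq_sum (hk : 1 ≤ k) (hp : ∀ i, p i ≤ n) :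
    Mcoeff n p = ∑ t ∈ range (n + 1),
      (-1) ^ t * (n.choose t : ℤ) * ∏ i, ((n - t).choose (n - p i) : ℤ) := by
  have : Nonempty (Fin k) := ⟨⟨0, hk⟩⟩
  have hmem : ∀ t, t ∈ range ((⨅ i, p i) + 1) ↔ ∀ i, t ≤ p i := fun t => by
    rw [mem_range, Nat.lt_succ_iff, le_ciInf_iff (OrderBot.bddBelow _)]
  refine sum_subset_zero_on_sdiff (fun t ht => ?_) (fun t ht => ?_) fun t ht => ?_
  · exact mem_range.2 (Nat.lt_succ_iff.2 (((hmem t).1 ht ⟨0, hk⟩).trans (hp _)))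
  · rw [mem_sdiff, mem_range, hmem, not_forall] at ht
    obtain ⟨htn, i, hi⟩ := ht
    rw [prod_eq_zero (mem_univ i) (by rw [Nat.choose_eq_zero_of_lt (by omega), Nat.cast_zero]),
      mul_zero]
  · congr 1
    refine prod_congr rfl fun i _ => ?_
    have hti := (hmem t).1 ht i
    have hin := hp i
    rw [Nat.choose_symm_of_eq_add (by omega : n - t = p i - t + (n - p i))]

theorem sum_Mcoeff_mul_prod_choose (hk : 1 ≤ k) (z : Fin k → ℕ) :
    ∑ p ∈ Fintype.piFinset fun _ : Fin k => range (n + 1),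
      Mcoeff n p * ∏ i, ((z i).choose (p i) : ℤ) =
    ∑ t ∈ range (n + 1), (-1) ^ t * (n.choose t : ℤ) * ∏ i, ((z i + n - t).choose n : ℤ) := by
  have hM : ∀ p ∈ Fintype.piFinset fun _ : Fin k => range (n + 1),
      Mcoeff n p = ∑ t ∈ range (n + 1),
        (-1) ^ t * (n.choose t : ℤ) * ∏ i, ((n - t).choose (n - p i) : ℤ) := fun p hp =>
    Mcoeff_eq_sum hk fun i => Nat.lt_succ_iff.1 (mem_range.1 (Fintype.mem_piFinset.1 hp i))
  rw [sum_congr rfl fun p hp => by rw [hM p hp, sum_mul], sum_comm]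
  refine sum_congr rfl fun t ht => ?_
  simp only [mul_assoc, ← mul_sum, ← prod_mul_distrib]
  rw [← prod_univ_sum (fun _ => range (n + 1))
    fun i p => ((n - t).choose (n - p) : ℤ) * ((z i).choose p : ℤ)]
  congr 2
  refine prod_congr rfl fun i _ => ?_
  exact_mod_cast sum_choose_mul_choose (Nat.lt_succ_iff.1 (mem_range.1 ht)) (z i)

theorem Mcoeff_pair (n p q : ℕ) : Mcoeff n ![p, q] = trinomial n p q := by
  rw [trinomial_eq]
  rcases lt_or_ge n p with hp | hp
  · rw [Nat.choose_eq_zero_of_lt hp, zero_mul, Mcoeff_eq_zero (i := 0) (by simpa using hp),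
      Nat.cast_zero]
  rcases lt_or_ge n q with hq | hq
  · rw [Nat.choose_eq_zero_of_lt (by omega : n - p < q), mul_zero,
      Mcoeff_eq_zero (i := 1) (by simpa using hq), Nat.cast_zero]
  rw [Mcoeff_eq_sum (by norm_num) (by simp [Fin.forall_fin_two, hp, hq]), Nat.cast_mul,
    ← sum_alternating_choose_mul_choose hp hq, mul_sum]
  symm
  refine sum_subset_zero_on_sdiff (range_mono (by omega)) (fun t ht => ?_) fun t ht => ?_
  · rw [mem_sdiff, mem_range, mem_range] at ht
    simp [Fin.prod_univ_two, Nat.choose_eq_zero_of_lt (by omega : n - t < n - p)]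
  · have htp := Nat.lt_succ_iff.1 (mem_range.1 ht)
    have hchoose : (n.choose p : ℤ) * p.choose t = n.choose t * (n - t).choose (n - p) := by
      rw [Nat.choose_symm_of_eq_add (by omega : n - t = n - p + (p - t))]
      exact_mod_cast Nat.choose_mul htp
    simp only [Fin.prod_univ_two, Matrix.cons_val_zero, Matrix.cons_val_one]
    linear_combination ((-1) ^ t * ((n - t).choose (n - q) : ℤ)) * hchoose

end Mcoeff

/-! ### The factorization identity -/

section HookDifference

variable {K : Type*} [Field K]

theorem hookContent_succ (n r : ℕ) (z : K) : hookContent n (r + 1) (z + 1) = hookContent n r z :=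
  prod_congr rfl fun l _ => by push_cast; ring

theorem hookContent_natCast_add_one {n t : ℕ} (ht : t ≤ n) (z : ℕ) :
    hookContent n t ((z : K) + 1) = n.factorial * ((z + n - t).choose n : ℕ) := by
  rw [← Nat.cast_mul, ← Nat.descFactorial_eq_factorial_mul_choose,
    ← descPochhammer_eval_eq_descFactorial K, descPochhammer_eval_eq_prod_range, hookContent,
    ← prod_range_reflect]
  refine prod_congr rfl fun l hl => ?_
  have hln := mem_range.1 hl
  rw [Nat.cast_sub (by omega : l ≤ n - 1), Nat.cast_sub (by omega : 1 ≤ n),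
    Nat.cast_sub (by omega : t ≤ z + n)]
  push_cast
  ring

theorem factorial_mul_coeff_sub_coeff [CharZero K] {m k : ℕ} {c : Perm (Fin (m + 1))}
    (hc : c.IsCycleOn Set.univ) (z : Fin k → K) :
    ((m + 1).factorial : K) * ((List.ofFn fun i => cycleSum (z i + 1)).prod.coeff c -
        (List.ofFn fun i => cycleSum (z i)).prod.coeff c) =
      ∑ t ∈ range (m + 2), (-1) ^ t * ((m + 1).choose t : K) *
        ∏ i, hookContent (m + 1) t (z i + 1) := by
  have hcoeff (y : Fin k → K) : ((m + 1).factorial : K) *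
      (List.ofFn fun i => cycleSum (y i)).prod.coeff c =
        ∑ r ∈ range (m + 1), (-1) ^ r * (m.choose r : K) * ∏ i, hookContent (m + 1) r (y i) := by
    rw [List.ofFn_eq_map, (HasHookEigenvalues.list_prod (List.finRange k) fun i =>
      hasHookEigenvalues_cycleSum (m + 1) (y i)).factorial_mul_coeff hc]
    simp only [← List.ofFn_eq_map, List.prod_ofFn]
  rw [mul_sub, hcoeff, hcoeff, sum_alternating_choose_succ m
    fun t => ∏ i, hookContent (m + 1) t (z i + 1)]
  simp only [hookContent_succ, mul_sub, sum_sub_distrib]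

end HookDifference

section Identity

variable {d n k : ℕ}

theorem weightedCount_natCast [NeZero d] (hk : 1 ≤ k) {π : Perm (Fin n)}
    (hπ : π.IsCycleOn Set.univ) {a : Fin n → rootsOfUnity d ℂ} (ha : ∏ i, a i ≠ 1)
    (z : Fin k → ℕ) :
    weightedCount (fun i => 1 + (d : ℂ) * z i) (gdEquiv d n (π, a)) =
      (Nat.card (Gd1n d n) : ℂ) ^ (k - 1) * ∑ p ∈ Fintype.piFinset fun _ : Fin k => range (n + 1),
        (Mcoeff n p : ℂ) * ∏ i, ((z i).choose (p i) : ℂ) := by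
  have hM := congrArg (Int.cast (R := ℂ)) (sum_Mcoeff_mul_prod_choose (n := n) hk z)
  push_cast at hM
  obtain ⟨m, rfl⟩ : ∃ m, n = m + 1 := Nat.exists_eq_succ_of_ne_zero <| by
    rintro rfl
    exact ha (Fintype.prod_empty _)
  have hhook : ((m + 1).factorial : ℂ) *
      ((List.ofFn fun i => cycleSum ((z i : ℂ) + 1)).prod.coeff π -
        (List.ofFn fun i => cycleSum (z i : ℂ)).prod.coeff π) =
      ((m + 1).factorial : ℂ) ^ k * ∑ t ∈ range (m + 2), (-1) ^ t * ((m + 1).choose t : ℂ) *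
          ∏ i, ((z i + (m + 1) - t).choose (m + 1) : ℂ) := by
    rw [factorial_mul_coeff_sub_coeff hπ, mul_sum]
    refine sum_congr rfl fun t ht => ?_
    simp only [hookContent_natCast_add_one (Nat.lt_succ_iff.1 (mem_range.1 ht)), prod_mul_distrib,
      prod_const, card_univ, Fintype.card_fin]
    ring
  have hcount := weightedCount_eq_coeff_sub_coeff hπ ha fun i => (z i : ℂ)
  have hd : (d : ℂ) ≠ 0 := Nat.cast_ne_zero.2 (NeZero.ne d)
  have hfactorial : ((m + 1).factorial : ℂ) ≠ 0 := Nat.cast_ne_zero.2 (Nat.factorial_ne_zero _)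
  obtain ⟨k, rfl⟩ := Nat.exists_eq_add_of_le' hk
  rw [hM, Nat.card_eq_fintype_card, card_Gd1n]
  refine mul_left_cancel₀ (mul_ne_zero hfactorial (pow_ne_zero (m + 1) hd)) ?_
  rw [mul_assoc, hcount, mul_left_comm, hhook]
  push_cast
  ring

theorem fixDim_le (g : GL (Fin n) ℂ) : fixDim g ≤ n := by
  simpa [fixDim] using Submodule.finrank_le (fixedSpace g)

theorem factorCount_eq_zero {c : GL (Fin n) ℂ} {r : Fin k → ℕ} {i : Fin k} (hi : n < r i) :
    factorCount (Gd1n d n) c r = 0 := by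
  rw [factorCount, Nat.card_eq_zero]
  exact .inl ⟨fun ⟨u, _, hu⟩ => (fixDim_le _).not_gt (hu i ▸ hi)⟩

theorem factorCount_eq_card [NeZero d] [DecidableEq (Gd1n d n)] (g : Gd1n d n) (r : Fin k → ℕ) :
    factorCount (Gd1n d n) (g : GL (Fin n) ℂ) r =
      #{u ∈ ({u | (List.ofFn u).prod = g} : Finset (Fin k → Gd1n d n)) |
        (fun i => fixDim (u i : GL (Fin n) ℂ)) = r} := by
  rw [factorCount, filter_filter, ← Fintype.card_subtype, ← Nat.card_eq_fintype_card]
  refine Nat.card_congr (subtypeEquivRight fun u => and_congr ?_ funext_iff.symm)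
  rw [← Subtype.coe_inj, ← Subgroup.coe_subtype, map_list_prod, List.map_ofFn]
  rfl

theorem sum_factorCount_mul [NeZero d] (g : Gd1n d n) (x : Fin k → ℂ) :
    ∑ r ∈ Fintype.piFinset fun _ : Fin k => range (n + 1),
      (factorCount (Gd1n d n) (g : GL (Fin n) ℂ) r : ℂ) * ∏ i, x i ^ r i = weightedCount x g := by
  classical
  rw [weightedCount, ← sum_fiberwise_of_maps_to
    (s := {u : Fin k → Gd1n d n | (List.ofFn u).prod = g})
    (g := fun u i => fixDim (u i : GL (Fin n) ℂ)) fun u _ =>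
      Fintype.mem_piFinset.2 fun i => mem_range.2 (Nat.lt_succ_iff.2 (fixDim_le _))]
  refine sum_congr rfl fun r _ => ?_
  rw [factorCount_eq_card, ← nsmul_eq_mul, ← sum_const]
  refine sum_congr (by congr!) fun u hu => ?_
  rw [← (mem_filter.1 hu).2]

theorem support_subset_piFinset {M : Type*} [Zero M] {f : (Fin k → ℕ) → M}
    (hf : ∀ r i, n < r i → f r = 0) :
    Function.support f ⊆ Fintype.piFinset fun _ : Fin k => range (n + 1) := fun r hr =>
  Fintype.mem_piFinset.2 fun i => mem_range.2 <| Nat.lt_succ_iff.2 <| not_lt.1 fun hi =>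
    hr (hf r i hi)

theorem finite_factorCount_ne_zero (c : GL (Fin n) ℂ) :
    {r : Fin k → ℕ | factorCount (Gd1n d n) c r ≠ 0}.Finite :=
  (finite_toSet _).subset (support_subset_piFinset fun _ _ => factorCount_eq_zero)

theorem finite_Mcoeff_ne_zero (n k : ℕ) : {p : Fin k → ℕ | Mcoeff n p ≠ 0}.Finite :=
  (finite_toSet _).subset (support_subset_piFinset fun _ _ => Mcoeff_eq_zero)

theorem eval_normBasisPoly {ι : Type} (hd : d ≠ 0) (p : ℕ) (i : ι) (z : ι → ℕ) :
    MvPolynomial.eval (fun j => 1 + (d : ℚ) * z j) (normBasisPoly d p i) = (z i).choose p := by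
  have hbasis : MvPolynomial.eval (fun j => 1 + (d : ℚ) * z j) (basisPoly d p i) =
      (d : ℚ) ^ p * (p.factorial * (z i).choose p) := by
    rw [← Nat.cast_mul, ← Nat.descFactorial_eq_factorial_mul_choose,
      ← descPochhammer_eval_eq_descFactorial ℚ, descPochhammer_eval_eq_prod_range,
      show (d : ℚ) ^ p = ∏ _j ∈ range p, (d : ℚ) by rw [prod_const, card_range],
      ← prod_mul_distrib, basisPoly, map_prod]
    refine prod_congr rfl fun j _ => ?_
    simp only [map_sub, MvPolynomial.eval_X, map_one, MvPolynomial.eval_C]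
    ring
  rw [normBasisPoly, map_mul, MvPolynomial.eval_C, hbasis, ← mul_assoc ((d : ℚ) ^ p)]
  refine inv_mul_cancel_left₀ ?_ _
  exact mul_ne_zero (pow_ne_zero _ (Nat.cast_ne_zero.2 hd)) (mod_cast p.factorial_ne_zero)

theorem eq_of_eval_one_add_mul_natCast_eq {ι : Type} (hd : d ≠ 0) {P Q : MvPolynomial ι ℚ}
    (h : ∀ z : ι → ℕ, MvPolynomial.eval (fun i => 1 + (d : ℚ) * z i) P =
      MvPolynomial.eval (fun i => 1 + (d : ℚ) * z i) Q) : P = Q := by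
  refine MvPolynomial.funext_set (fun _ => Set.range fun z : ℕ => 1 + (d : ℚ) * z)
    (fun _ => Set.infinite_range_of_injective fun y z hyz => ?_) fun x hx => ?_
  · simpa [hd] using hyz
  · choose z hz using fun i => hx i (Set.mem_univ i)
    obtain rfl : (fun i => 1 + (d : ℚ) * z i) = x := funext hz
    exact h z

theorem factorization_identity [NeZero d] (hk : 1 ≤ k) {c : GL (Fin n) ℂ} {π : Perm (Fin n)}
    {a : Fin n → rootsOfUnity d ℂ} (hc : (c : Matrix (Fin n) (Fin n) ℂ) = monomialMatrix π a)
    (hπ : π.IsCycleOn Set.univ) (ha : ∏ i, a i ≠ 1) :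
    MvPolynomial.C (1 / (Nat.card (Gd1n d n) : ℚ) ^ (k - 1)) *
        ∑ᶠ r : Fin k → ℕ, MvPolynomial.C (factorCount (Gd1n d n) c r : ℚ) *
          ∏ i, MvPolynomial.X i ^ r i =
      ∑ᶠ p : Fin k → ℕ, MvPolynomial.C (Mcoeff n p : ℚ) * ∏ i, normBasisPoly d (p i) i := by
  obtain rfl : c = gdEquiv d n (π, a) := Units.ext hc
  rw [finsum_eq_sum_of_support_subset _ <| support_subset_piFinset fun r i hi => by
      rw [factorCount_eq_zero hi, Nat.cast_zero, map_zero, zero_mul],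
    finsum_eq_sum_of_support_subset _ <| support_subset_piFinset fun p i hi => by
      rw [Mcoeff_eq_zero hi, Int.cast_zero, map_zero, zero_mul]]
  refine eq_of_eval_one_add_mul_natCast_eq (NeZero.ne d) fun z => ?_
  have hcount : ∑ r ∈ Fintype.piFinset fun _ : Fin k => range (n + 1),
      (factorCount (Gd1n d n) (gdEquiv d n (π, a) : GL (Fin n) ℂ) r : ℚ) *
        ∏ i, (1 + (d : ℚ) * z i) ^ r i =
      (Nat.card (Gd1n d n) : ℚ) ^ (k - 1) * ∑ p ∈ Fintype.piFinset fun _ : Fin k => range (n + 1),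
        (Mcoeff n p : ℚ) * ∏ i, ((z i).choose (p i) : ℚ) := by
    exact_mod_cast (sum_factorCount_mul _ _).trans (weightedCount_natCast hk hπ ha z)
  simp only [map_mul, map_sum, map_prod, map_pow, MvPolynomial.eval_C, MvPolynomial.eval_X,
    eval_normBasisPoly (NeZero.ne d)]
  rw [hcount, one_div, inv_mul_cancel_left₀ (pow_ne_zero _ (Nat.cast_ne_zero.2 Nat.card_pos.ne'))]

end Identity

theorem finite_pairs {P : (Fin 2 → ℕ) → Prop} (h : {r | P r}.Finite) :
    {rs : ℕ × ℕ | P ![rs.1, rs.2]}.Finite :=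
  h.preimage (finTwoArrowEquiv ℕ).symm.injective.injOn

end ReflFact

end

open ReflFact in
theorem theorem1p3_general {d n : ℕ} [NeZero d] {c : Matrix.GeneralLinearGroup (Fin n) ℂ}
    {π : Equiv.Perm (Fin n)} {a : Fin n → rootsOfUnity d ℂ}
    (hc : (c : Matrix (Fin n) (Fin n) ℂ) = monomialMatrix π a) (hπ : π.IsCycleOn Set.univ)
    (ha : ∏ i, a i ≠ 1) :
    ({rs : ℕ × ℕ | factorCount (Gd1n d n) c ![rs.1, rs.2] ≠ 0}.Finite ∧
      {pq : ℕ × ℕ | trinomial n pq.1 pq.2 ≠ 0}.Finite ∧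
      MvPolynomial.C (1 / (Nat.card (Gd1n d n) : ℚ)) *
          ∑ᶠ rs : ℕ × ℕ,
            MvPolynomial.C (factorCount (Gd1n d n) c ![rs.1, rs.2] : ℚ) *
              MvPolynomial.X (0 : Fin 2) ^ rs.1 * MvPolynomial.X (1 : Fin 2) ^ rs.2
        = ∑ᶠ pq : ℕ × ℕ,
            MvPolynomial.C (trinomial n pq.1 pq.2 : ℚ) *
              normBasisPoly d pq.1 (0 : Fin 2) *
              normBasisPoly d pq.2 (1 : Fin 2)) ∧
    (∀ k : ℕ, 1 ≤ k →
      {r : Fin k → ℕ | factorCount (Gd1n d n) c r ≠ 0}.Finite ∧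
      {p : Fin k → ℕ | Mcoeff n p ≠ 0}.Finite ∧
      MvPolynomial.C (1 / (Nat.card (Gd1n d n) : ℚ) ^ (k - 1)) *
          ∑ᶠ r : Fin k → ℕ,
            MvPolynomial.C (factorCount (Gd1n d n) c r : ℚ) *
              ∏ i, MvPolynomial.X i ^ r i
        = ∑ᶠ p : Fin k → ℕ,
            MvPolynomial.C (Mcoeff n p : ℚ) *
              ∏ i, normBasisPoly d (p i) i) := by
  refine ⟨⟨finite_pairs (finite_factorCount_ne_zero c), ?_, ?_⟩, fun k hk =>
    ⟨finite_factorCount_ne_zero c, finite_Mcoeff_ne_zero n k,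
      factorization_identity hk hc hπ ha⟩⟩
  · refine (finite_pairs (finite_Mcoeff_ne_zero n 2)).subset fun pq hpq => ?_
    rw [Set.mem_ofPred_eq, Mcoeff_pair]
    exact Int.natCast_ne_zero.2 hpq
  · have h := factorization_identity (k := 2) one_le_two hc hπ ha
    rw [← finsum_comp_equiv (finTwoArrowEquiv ℕ).symm,
      ← finsum_comp_equiv (finTwoArrowEquiv ℕ).symm] at h
    simp only [finTwoArrowEquiv_symm_apply, Fin.prod_univ_two, Matrix.cons_val_zero,
      Matrix.cons_val_one, Mcoeff_pair, Int.cast_natCast, ← mul_assoc, Nat.add_one_sub_one,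
      pow_one] at h
    exact h

/-- Factorizations of an arbitrary Coxeter element `c` of `G(d, 1, n)`, counted by the fixed space
dimensions of the factors. The formal sums run over all tuples of nonnegative integers; that they
are finite sums is part of the claim. -/
theorem theorem1p3 (d n : ℕ) (hd : 1 < d) (c : Matrix.GeneralLinearGroup (Fin n) ℂ)
    (hc : ReflFact.IsCoxeterElement (ReflFact.Gd1n d n) c) :
    ({rs : ℕ × ℕ | ReflFact.factorCount (ReflFact.Gd1n d n) c ![rs.1, rs.2] ≠ 0}.Finite ∧
      {pq : ℕ × ℕ | ReflFact.trinomial n pq.1 pq.2 ≠ 0}.Finite ∧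
      MvPolynomial.C (1 / (Nat.card (ReflFact.Gd1n d n) : ℚ)) *
          ∑ᶠ rs : ℕ × ℕ,
            MvPolynomial.C (ReflFact.factorCount (ReflFact.Gd1n d n) c ![rs.1, rs.2] : ℚ) *
              MvPolynomial.X (0 : Fin 2) ^ rs.1 * MvPolynomial.X (1 : Fin 2) ^ rs.2
        = ∑ᶠ pq : ℕ × ℕ,
            MvPolynomial.C (ReflFact.trinomial n pq.1 pq.2 : ℚ) *
              ReflFact.normBasisPoly d pq.1 (0 : Fin 2) *
              ReflFact.normBasisPoly d pq.2 (1 : Fin 2)) ∧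
    (∀ k : ℕ, 1 ≤ k →
      {r : Fin k → ℕ | ReflFact.factorCount (ReflFact.Gd1n d n) c r ≠ 0}.Finite ∧
      {p : Fin k → ℕ | ReflFact.Mcoeff n p ≠ 0}.Finite ∧
      MvPolynomial.C (1 / (Nat.card (ReflFact.Gd1n d n) : ℚ) ^ (k - 1)) *
          ∑ᶠ r : Fin k → ℕ,
            MvPolynomial.C (ReflFact.factorCount (ReflFact.Gd1n d n) c r : ℚ) *
              ∏ i, MvPolynomial.X i ^ r i
        = ∑ᶠ p : Fin k → ℕ,
            MvPolynomial.C (ReflFact.Mcoeff n p : ℚ) *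
              ∏ i, ReflFact.normBasisPoly d (p i) i) := by
  have : NeZero d := ⟨by omega⟩
  obtain ⟨π, a, hca, hπ, ha⟩ := hc.exists_eq_monomialMatrix hd
  exact theorem1p3_general hca hπ ha
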